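/- **Setting.** Let $k\ge 1$, and let $w_1,\dots,w_k$ be server weights with $w_1\ge 0$ such that, for $1\le i<k$, $w_{i+1}$ is an integer multiple of $w_i$ and $w_{i+1}>w_i$. Let $M$ be a set of points with the uniform metric, with a fixed well-order (for finite $M$, any total order) used for breaking ties. A configuration is a tuple $C=(C[1],\dots,C[k])\in M^k$, where server $j$ has weight $w_j$; moving from $C$ to $C'$ costs $\sum_{j:\,C[j]\ne C'[j]}w_j$. A request is a point of $M$; it is served in configuration $C$ if $C[j]$ equals it for some $j$. Request sequences are finite strings over $M$. **Constants.** $d_\ell=2^{5^{\ell-1}-1}$; $h(n)=1+\frac12+\dots+\frac1n$; $c_1=1$ and $c_\ell=(1+h(d_\ell-1))\,c_{\ell-1}+2h(d_\ell-1)$ for $\ell>1$. For a finitely supported non-negative vector $v$ indexed by $M$, $\mathrm{top}_n(v)$ is the set of the $n$ points with the $n$ largest coordinates in $v$, ties being broken by the fixed order (all of $M$ if $|M|\le n$); $u_p$ is the unit vector of the point $p$. **Phases.** For a finite set $H\subseteq M$, the following notions are defined together by recursion on $\ell$. * A $(1,H)$-phase is a string $\rho$ over $H\cup\{p\}$, for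 some $p\notin H$, that contains $p$; its request sequence is $\rho$ and its demand vector is $u_p$. * For $1\le\ell<k$, an $(\ell,H)$-multiphase is a sequence of $n=w_{\ell+1}/w_\ell$ $(\ell,H)$-phases with request sequences $\rho_1,\dots,\rho_n$ such that each $\rho_i$ is the longest prefix of $\rho_i\cdots\rho_n$ that is the request sequence of some $(\ell,H)$-phase. Its request sequence is $\rho_1\cdots\rho_n$, its demand vector $v$ is the sum of the demand vectors of the $n$ phases, and its critical set is $\mathrm{top}_{d_{\ell+1}-1}(v)$. * For $1<\ell\le k$, an $(\ell,H)$-phase consists of an $(\ell-1,H)$-multiphase with request sequence $\rho^0$, demand vector $v^0$ and critical set $S$, and, for each $p\in S$, an $(\ell-1,H\cup\{p\})$-multiphase with request sequence $\rho^p$ and demand vector $v^p$, such that: every $\rho^p$ is a prefix of the longest of these strings, $\rho'$; $\rho^0$ is the longest prefix of $\rho^0\rho'$ that is the request sequence of some $(\ell-1,H)$-multiphase; and each $\rho^p$ is the longest prefix of $\rho'$ that is the request sequence of some $(\ell-1,H\cup\{p\})$-multiphase. Its request sequence is $\rho^0\rho'$ and its demand vector is $v^0+\sum_{p\in S}v^p$.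 **Strategies.** An $\ell$-phase strategy ($1\le\ell\le k$), respectively an $\ell$-multiphase strategy ($1\le\ell\le k-1$), is a randomized online algorithm (a random choice of a deterministic online algorithm) whose initial input is a set $H$ of at most $k-\ell$ points and a configuration $C_0$ with $H\subseteq\{C_0[\ell+1],\dots,C_0[k]\}$. Reading the requests of an arbitrary sequence $\rho$ one at a time, it either serves the current request by choosing a new configuration, or terminates without serving it and returns a vector. It is required to satisfy the following for all $H,C_0,\rho$ and all outcomes of the random choice. 1. It moves only the lightest $\ell$ servers $1,\dots,\ell$. 2. If $\rho$ is not the request sequence of any $(\ell,H)$-phase (resp. multiphase), but some prefix of $\rho$ is, then it serves exactly the longest such prefix $\rho^*$, terminates, and returns the demand vector of the $(\ell,H)$-phase (resp. multiphase) whose request sequence is $\rho^*$. 3. Otherwise it serves the whole of $\rho$ and waits for more requests. 4. Its expected cost is at most $c_\ell w_\ell$ (resp. $c_\ell w_{\ell+1}$). **Lemma.** * (a) A $1$-phase strategy exists. * (b) For every $\ell\in\{1,\dots,k-1\}$, if an $\ell$-phase strategy exists, then an $\ell$-multiphase strategy exists. * (c) For every $\ell\in\{2,\dots,k\}$, if an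 $(\ell-1)$-multiphase strategy exists, then an $\ell$-phase strategy exists. * (d) Consequently, a $k$-phase strategy exists: from any initial configuration it serves exactly the longest prefix of the input that is the request sequence of a $(k,\emptyset)$-phase and returns its demand vector (if the input has such a prefix and is not itself such a request sequence; otherwise it serves all of the input and waits), with expected cost at most $c_kw_k$. -/

import Mathlib

noncomputable section

namespace KServer

universe u

/-! ### Constants -/

/-- `d_ℓ = 2 ^ (5 ^ (ℓ - 1) - 1)`, used for `ℓ ≥ 1`. -/
def d (l : ℕ) : ℕ := 2 ^ (5 ^ (l - 1) - 1)

/-- `h n = 1 + 1/2 + ⋯ + 1/n`. -/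
def h (n : ℕ) : ℝ := (harmonic n : ℝ)

/-- `c_1 = 1` and `c_ℓ = (1 + h (d_ℓ - 1)) c_{ℓ-1} + 2 h (d_ℓ - 1)` for `ℓ > 1`
(the value at `0` is never used). -/
def c : ℕ → ℝ
  | 0 => 0
  | 1 => 1
  | l + 2 => (1 + h (d (l + 2) - 1)) * c (l + 1) + 2 * h (d (l + 2) - 1)

/-! ### Strings and vectors indexed by points -/

/-- `x` is the longest prefix of `y` with the property `P`. -/
def IsLongestPrefix {M : Type u} (P : List M → Prop) (x y : List M) : Prop :=
  x <+: y ∧ P x ∧ ∀ z, z <+: y → P z → z.length ≤ x.length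

/-- `q` precedes `p` when points are ranked by decreasing coordinate in `v`,
ties being broken by the order of the points. -/
def Precedes {M : Type u} [LinearOrder M] (v : M →₀ ℝ) (q p : M) : Prop :=
  v p < v q ∨ (v q = v p ∧ q < p)

/-- The points preceded by fewer than `n` points. -/
def topSet {M : Type u} [LinearOrder M] (n : ℕ) (v : M →₀ ℝ) : Set M :=
  {p | {q | Precedes v q p}.encard < n}

theorem topSet_finite {M : Type u} [LinearOrder M] (n : ℕ) (v : M →₀ ℝ) :
    (topSet n v).Finite := by
  by_contra hinf
  obtain ⟨F, hF, hcard⟩ := Set.Infinite.exists_subset_card_eq hinf (n + 1)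
  have hne : F.Nonempty := by
    rw [← Finset.card_pos]; omega
  obtain ⟨p, hp, hmax⟩ := F.exists_max_image (fun q => toLex (-(v q), q)) hne
  have hsub : ((F.erase p : Finset M) : Set M) ⊆ {q | Precedes v q p} := by
    intro q hq
    have hq' := Finset.mem_erase.1 (Finset.mem_coe.1 hq)
    have h1 := hmax q hq'.2
    rw [Prod.Lex.toLex_le_toLex] at h1
    rcases h1 with h1 | ⟨h1, h2⟩
    · exact Or.inl (by simpa using h1)
    · exact Or.inr ⟨by simpa using h1, lt_of_le_of_ne h2 hq'.1⟩
  have h2 : ((F.erase p : Finset M) : Set M).encard < n :=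
    lt_of_le_of_lt (Set.encard_le_encard hsub) (hF hp)
  rw [Set.encard_coe_eq_coe_finsetCard, Finset.card_erase_of_mem hp, hcard] at h2
  simp at h2

/-- The set of the `n` points with the `n` largest coordinates in `v` (ties are broken by the order
of the points). It consists of all points if there are at most `n` points. -/
def top {M : Type u} [LinearOrder M] (n : ℕ) (v : M →₀ ℝ) : Finset M :=
  (topSet_finite n v).toFinset

/-! ### Phases and multiphases

A predicate `P : Finset M → List M → (M →₀ ℝ) → Prop` is read as:
`P H ρ v` holds if there is a `P`-structure for the set `H` with request sequence `ρ` and demand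
vector `v`. -/

/-- `ρ` is the request sequence of some `P`-structure for `H`. -/
def IsRequestSeq {M : Type u} (P : Finset M → List M → (M →₀ ℝ) → Prop) (H : Finset M)
    (ρ : List M) : Prop :=
  ∃ v, P H ρ v

/-- There is a sequence of `n` `P`-structures for `H` with request sequences `ρ_1, …, ρ_n` and demand
vectors `v_1, …, v_n`, each `ρ_i` being the longest prefix of `ρ_i ⋯ ρ_n` that is the request sequence
of some `P`-structure for `H`, with `ρ = ρ_1 ⋯ ρ_n` and `v = v_1 + ⋯ + v_n`. -/
def IsSeqOf {M : Type u} (P : Finset M → List M → (M →₀ ℝ) → Prop) (n : ℕ) (H : Finset M)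
    (ρ : List M) (v : M →₀ ℝ) : Prop :=
  ∃ L : List (List M × (M →₀ ℝ)),
    L.length = n ∧
    (∀ Q ∈ L, P H Q.1 Q.2) ∧
    (∀ (i : ℕ) (hi : i < L.length),
      IsLongestPrefix (IsRequestSeq P H) (L[i]).1 ((L.drop i).map Prod.fst).flatten) ∧
    ρ = (L.map Prod.fst).flatten ∧
    v = (L.map Prod.snd).sum

/-- The number `w_{ℓ+1} / w_ℓ`, an integer for the weights under consideration. -/
def ratio (w : ℕ → ℝ) (l : ℕ) : ℕ := ⌊w (l + 1) / w l⌋₊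

/-- `IsPhase w ℓ H ρ v`: there is an `(ℓ, H)`-phase with request sequence `ρ` and demand vector `v`,
where `w ℓ` is the weight of the `ℓ`-th lightest server. In the recursive case `ρ0`, `v0` belong to
the explore part, and `r p`, `s p` are the request sequence and the demand vector of the
`p`-th multiphase of the exploit part, for `p` in the critical set `S`; the string `ρ'` is the longest
one of the prefix chain `{r p | p ∈ S}`. -/
def IsPhase {M : Type u} [LinearOrder M] (w : ℕ → ℝ) :
    ℕ → Finset M → List M → (M →₀ ℝ) → Prop
  | 0, _, _, _ => False
  | 1, H, ρ, v =>
      ∃ p, p ∉ H ∧ p ∈ ρ ∧ (∀ x ∈ ρ, x ∈ H ∨ x = p) ∧ v = Finsupp.single p 1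
  | l + 2, H, ρ, v =>
      ∃ (ρ0 : List M) (v0 : M →₀ ℝ) (S : Finset M) (r : M → List M) (s : M → (M →₀ ℝ))
        (ρ' : List M),
        IsSeqOf (IsPhase w (l + 1)) (ratio w (l + 1)) H ρ0 v0 ∧
        S = top (d (l + 2) - 1) v0 ∧
        (∀ p ∈ S, IsSeqOf (IsPhase w (l + 1)) (ratio w (l + 1)) (insert p H) (r p) (s p)) ∧
        (∃ p ∈ S, ρ' = r p) ∧
        (∀ p ∈ S, r p <+: ρ') ∧
        IsLongestPrefix
          (IsRequestSeq (IsSeqOf (IsPhase w (l + 1)) (ratio w (l + 1))) H) ρ0 (ρ0 ++ ρ') ∧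
        (∀ p ∈ S, IsLongestPrefix
          (IsRequestSeq (IsSeqOf (IsPhase w (l + 1)) (ratio w (l + 1))) (insert p H)) (r p) ρ') ∧
        ρ = ρ0 ++ ρ' ∧
        v = v0 + ∑ p ∈ S, s p

/-- `IsMultiphase w ℓ H ρ v`: there is an `(ℓ, H)`-multiphase with request sequence `ρ` and demand
vector `v`. -/
def IsMultiphase {M : Type u} [LinearOrder M] (w : ℕ → ℝ) (l : ℕ) :
    Finset M → List M → (M →₀ ℝ) → Prop :=
  IsSeqOf (IsPhase w l) (ratio w l)

/-! ### Configurations, solutions and online algorithms -/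

/-- A configuration of `k` servers. The entry with index `j : Fin k` is the position of the server
number `j + 1`, whose weight is `w (j + 1)`. -/
abbrev Config (k : ℕ) (M : Type u) : Type u := Fin k → M

/-- The cost of moving from one configuration to another on the uniform metric. -/
def moveCost {k : ℕ} {M : Type u} [DecidableEq M] (w : ℕ → ℝ) (C C' : Config k M) : ℝ :=
  ∑ j : Fin k, if C j ≠ C' j then w ((j : ℕ) + 1) else 0

/-- The cost of the sequence of configurations that starts with `C` and continues with a list. -/
def solutionCost {k : ℕ} {M : Type u} [DecidableEq M] (w : ℕ → ℝ) :
    Config k M → List (Config k M) → ℝ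
  | _, [] => 0
  | C, C' :: t => moveCost w C C' + solutionCost w C' t

/-- The `i`-th configuration serves the `i`-th request, for every `i`. -/
def Serves {k : ℕ} {M : Type u} (σ : List M) (t : List (Config k M)) : Prop :=
  List.Forall₂ (fun x C => ∃ j, C j = x) σ t

/-- A deterministic online algorithm: given the list of the requests it has served so far and the
next request, it either moves its servers to a new configuration (to serve the request), or
terminates without serving the request and returns a vector. -/
abbrev OnlineAlg (k : ℕ) (M : Type u) : Type u :=
  List M → M → Config k M ⊕ (M →₀ ℝ)

/-- The outcome of running an online algorithm on a finite sequence of requests: the requests that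
were served, the configurations in which they were served, and the vector returned (`none` if the
algorithm has not terminated and waits for more requests). -/
structure Outcome (k : ℕ) (M : Type u) where
  served : List M
  configs : List (Config k M)
  result : Option (M →₀ ℝ)

/-- Run the algorithm `A`, which has already served the requests in the first list, on the second
list. -/
def runFrom {k : ℕ} {M : Type u} (A : OnlineAlg k M) : List M → List M → Outcome k M
  | _, [] => ⟨[], [], none⟩
  | past, x :: ρ =>
      match A past x with
      | Sum.inr v => ⟨[], [], some v⟩
      | Sum.inl C =>
          let o := runFrom A (past ++ [x]) ρ
          ⟨x :: o.served, C :: o.configs, o.result⟩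

/-- Run the algorithm on a sequence of requests. -/
def run {k : ℕ} {M : Type u} (A : OnlineAlg k M) (ρ : List M) : Outcome k M := runFrom A [] ρ

/-- A randomized online algorithm whose initial input is a finite set of points and an initial
configuration: a random seed is drawn from a fixed probability distribution, and every value of the
seed gives a deterministic online algorithm for every initial input. -/
structure RandomizedAlg (k : ℕ) (M : Type u) where
  Seed : Type
  law : PMF Seed
  alg : Seed → Finset M → Config k M → OnlineAlg k M

/-- The expected cost on the initial input `H, C0` and the online input `ρ`. -/
def RandomizedAlg.expectedCost {k : ℕ} {M : Type u} [DecidableEq M] (A : RandomizedAlg k M)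
    (w : ℕ → ℝ) (H : Finset M) (C0 : Config k M) (ρ : List M) : ENNReal :=
  ∑' ω, A.law ω * ENNReal.ofReal (solutionCost w C0 (run (A.alg ω H C0) ρ).configs)

/-- `A` is a strategy for the structures described by `P`, which uses only the `ℓ` lightest servers
and has expected cost at most `b`. -/
structure IsStrategy {k : ℕ} {M : Type u} [DecidableEq M] (w : ℕ → ℝ) (l : ℕ)
    (P : Finset M → List M → (M →₀ ℝ) → Prop) (b : ℝ) (A : RandomizedAlg k M) : Prop where
  /-- The served requests are served, in the configurations visited by the algorithm. -/
  serves : ∀ (H : Finset M) (C0 : Config k M), H.card ≤ k - l →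
    (∀ p ∈ H, ∃ j : Fin k, l ≤ (j : ℕ) ∧ C0 j = p) → ∀ (ρ : List M) (ω : A.Seed),
      Serves (run (A.alg ω H C0) ρ).served (run (A.alg ω H C0) ρ).configs
  /-- Only the `ℓ` lightest servers are moved. -/
  light : ∀ (H : Finset M) (C0 : Config k M), H.card ≤ k - l →
    (∀ p ∈ H, ∃ j : Fin k, l ≤ (j : ℕ) ∧ C0 j = p) → ∀ (ρ : List M) (ω : A.Seed),
      ∀ C ∈ (run (A.alg ω H C0) ρ).configs, ∀ j : Fin k, l ≤ (j : ℕ) → C j = C0 j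
  /-- If `ρ` is not the request sequence of a structure but has such a prefix, then the algorithm
  serves exactly the longest such prefix, terminates, and returns the demand vector. -/
  terminates : ∀ (H : Finset M) (C0 : Config k M), H.card ≤ k - l →
    (∀ p ∈ H, ∃ j : Fin k, l ≤ (j : ℕ) ∧ C0 j = p) → ∀ (ρ : List M) (ω : A.Seed),
      ¬ IsRequestSeq P H ρ → ∀ ρs, IsLongestPrefix (IsRequestSeq P H) ρs ρ →
        (run (A.alg ω H C0) ρ).served = ρs ∧
        ∀ v, P H ρs v → (run (A.alg ω H C0) ρ).result = some v
  /-- Otherwise the algorithm serves the whole of `ρ` and waits for more requests. -/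
  waits : ∀ (H : Finset M) (C0 : Config k M), H.card ≤ k - l →
    (∀ p ∈ H, ∃ j : Fin k, l ≤ (j : ℕ) ∧ C0 j = p) → ∀ (ρ : List M) (ω : A.Seed),
      ¬ (¬ IsRequestSeq P H ρ ∧ ∃ ρs, ρs <+: ρ ∧ IsRequestSeq P H ρs) →
        (run (A.alg ω H C0) ρ).served = ρ ∧ (run (A.alg ω H C0) ρ).result = none
  /-- The expected cost is at most `b` on every input. -/
  cost : ∀ (H : Finset M) (C0 : Config k M), H.card ≤ k - l →
    (∀ p ∈ H, ∃ j : Fin k, l ≤ (j : ℕ) ∧ C0 j = p) → ∀ (ρ : List M),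
      A.expectedCost w H C0 ρ ≤ ENNReal.ofReal b

/-- `A` is an `ℓ`-phase strategy. -/
def IsPhaseStrategy {k : ℕ} {M : Type u} [LinearOrder M] (w : ℕ → ℝ) (l : ℕ)
    (A : RandomizedAlg k M) : Prop :=
  IsStrategy w l (IsPhase w l) (c l * w l) A

/-- `A` is an `ℓ`-multiphase strategy. -/
def IsMultiphaseStrategy {k : ℕ} {M : Type u} [LinearOrder M] (w : ℕ → ℝ) (l : ℕ)
    (A : RandomizedAlg k M) : Prop :=
  IsStrategy w l (IsMultiphase w l) (c l * w (l + 1)) A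

end KServer

end

/-! For fixed `H`, the request sequences of phases (or multiphases) form a language that is convex
in the prefix order: a string between two members is a member. Hence being `Dead`, that is, having
passed a member and left the language, persists under extension. A strategy has to serve exactly
while the input is not dead, so it amounts to a plan: a random configuration for every non-dead
string. `IsStrategy.hasPlan` and `HasPlan.exists_strategy` translate between the two. The returned
vector causes no trouble, since the request sequence determines it (`Good`).

At level 1 the lightest server moves once, to the first request outside `H`. A multiphase is an
iterated concatenation of phases, and costs of plans add under concatenation (`HasPlan.concat`),
because the second bound holds from every admissible starting configuration and the seeds are
independent. Thus `w (l+1) / w l` phases cost at most `c l * w (l+1)`.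

A phase of level ℓ > 1 is a multiphase followed by an exploit part with critical set `S`. For the
latter (`HasPlan.exploit`), order `S` uniformly at random. Take the first `p` in this order whose
multiphase is not over, and adopt the configuration that the plan for `insert p H`, with server ℓ
placed at `p`, would have after the whole exploit string so far. A point is ever followed only if it
precedes all points whose multiphases end no earlier than its own. The probability is at most one
over the number of those points, and these bounds sum to at most the harmonic number of `S.card`,
where `S.card ≤ d ℓ - 1`. Each followed point costs one jump, at most `w 1 + ⋯ + w ℓ ≤ 2 * w ℓ`,
plus its own plan, at most `c (ℓ-1) * w ℓ` in expectation. Adding the explore part gives the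
recursion for `c ℓ`. -/

noncomputable section

namespace KServer

universe u v

/-! ### Languages of finite strings -/

section Language

variable {M : Type u} {L : List M → Prop} {σ τ ρ : List M}

/-- `σ` is not in the language `L`, but has a prefix that is. -/
def Dead (L : List M → Prop) (σ : List M) : Prop :=
  ¬ L σ ∧ ∃ τ, τ <+: σ ∧ L τ

/-- A language that contains every string between two of its members in the prefix order. -/
def ConvexLang (L : List M → Prop) : Prop :=
  ∀ ⦃x y z⦄, x <+: y → y <+: z → L x → L z → L y

theorem not_dead_nil : ¬ Dead L [] := by
  rintro ⟨h, τ, hτ, hL⟩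
  rw [List.prefix_nil.1 hτ] at hL
  exact h hL

theorem not_dead_of_mem (h : L σ) : ¬ Dead L σ := fun hd => hd.1 h

/-- If `τ` returned to the language, convexity between the earlier member and `τ` would put `σ` in
it. -/
theorem Dead.mono (hL : ConvexLang L) (h : Dead L σ) (hστ : σ <+: τ) : Dead L τ := by
  obtain ⟨h1, ρ, hρ, hρL⟩ := h
  exact ⟨fun h2 => h1 (hL hρ hστ hρL h2), ρ, hρ.trans hστ, hρL⟩

theorem IsLongestPrefix.eq {ρ' : List M} (h : IsLongestPrefix L ρ σ)
    (h' : IsLongestPrefix L ρ' σ) : ρ = ρ' :=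
  (List.prefix_of_prefix_length_le h.1 h'.1 (h'.2.2 _ h.1 h.2.1)).eq_of_length
    (le_antisymm (h'.2.2 _ h.1 h.2.1) (h.2.2 _ h'.1 h'.2.1))

theorem IsLongestPrefix.of_prefix (h : IsLongestPrefix L ρ σ) (h1 : ρ <+: τ) (h2 : τ <+: σ) :
    IsLongestPrefix L ρ τ :=
  ⟨h1, h.2.1, fun z hz hzL => h.2.2 z (hz.trans h2) hzL⟩

theorem isLongestPrefix_self (h : L σ) : IsLongestPrefix L σ σ :=
  ⟨List.prefix_rfl, h, fun _ hz _ => hz.length_le⟩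

theorem IsLongestPrefix.dead_of_prefix (h : IsLongestPrefix L ρ σ) (h1 : ρ <+: τ) (h2 : τ <+: σ)
    (hne : τ ≠ ρ) : Dead L τ := by
  refine ⟨fun h3 => hne ?_, ρ, h1, h.2.1⟩
  exact (isLongestPrefix_self h3).eq (h.of_prefix h1 h2)

/-- After death no longer member can appear, so the longest prefix is settled without knowledge of
later requests. -/
theorem IsLongestPrefix.extend (hL : ConvexLang L) (h : IsLongestPrefix L ρ σ) (hd : Dead L σ)
    (h1 : σ <+: τ) : IsLongestPrefix L ρ τ := by
  refine ⟨h.1.trans h1, h.2.1, fun z hz hzL => ?_⟩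
  rcases List.prefix_or_prefix_of_prefix hz h1 with h2 | h2
  · exact h.2.2 z h2 hzL
  · exact absurd hzL (hd.mono hL h2).1

/-- The longest prefix of `σ` that is not dead. -/
def core (L : List M → Prop) (σ : List M) : List M :=
  open Classical in σ.take (Nat.findGreatest (fun n => ¬ Dead L (σ.take n)) σ.length)

theorem core_prefix : core L σ <+: σ := List.take_prefix _ _

theorem not_dead_core : ¬ Dead L (core L σ) := by
  classical
  have := Nat.findGreatest_spec (P := fun n => ¬ Dead L (σ.take n)) (Nat.zero_le σ.length)
    (by simpa using not_dead_nil)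
  unfold core
  convert this

theorem prefix_core (h : τ <+: σ) (hd : ¬ Dead L τ) : τ <+: core L σ := by
  classical
  have h1 : τ = σ.take τ.length := List.prefix_iff_eq_take.1 h
  have h2 := Nat.le_findGreatest (P := fun n => ¬ Dead L (σ.take n)) h.length_le (h1 ▸ hd)
  rw [h1]
  unfold core
  convert List.take_prefix_take_left h2

theorem core_eq_self (h : ¬ Dead L σ) : core L σ = σ :=
  core_prefix.eq_of_length_le (prefix_core List.prefix_rfl h).length_le

theorem core_mono (h : σ <+: τ) : core L σ <+: core L τ :=
  prefix_core (core_prefix.trans h) not_dead_core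

/-- A non-dead string with a prefix in the language is itself in the language. If no prefix is a
member, the core is all of `σ`. -/
theorem isLongestPrefix_core (h : ∃ τ, τ <+: σ ∧ L τ) :
    IsLongestPrefix L (core L σ) σ := by
  have key : ∀ z, z <+: σ → L z → z.length ≤ (core L σ).length := fun z hz hzL =>
    (prefix_core hz (not_dead_of_mem hzL)).length_le
  refine ⟨core_prefix, ?_, key⟩
  obtain ⟨τ, hτ, hτL⟩ := h
  by_contra hc
  exact not_dead_core ⟨hc, τ, prefix_core hτ (not_dead_of_mem hτL), hτL⟩

theorem Dead.isLongestPrefix_core (hd : Dead L σ) : IsLongestPrefix L (core L σ) σ :=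
  KServer.isLongestPrefix_core hd.2

theorem IsLongestPrefix.core_eq (h : IsLongestPrefix L ρ σ) : core L σ = ρ := by
  by_cases hd : Dead L σ
  · exact hd.isLongestPrefix_core.eq h
  · rw [core_eq_self hd]
    by_contra hne
    exact hd (h.dead_of_prefix h.1 List.prefix_rfl hne)

/-! #### Concatenation -/

/-- Strings whose longest prefix in `L₁` is followed by a member of a language that depends on this
prefix. -/
def concatLang (L₁ : List M → Prop) (L₂ : List M → List M → Prop) (σ : List M) : Prop :=
  ∃ ρ τ, IsLongestPrefix L₁ ρ σ ∧ σ = ρ ++ τ ∧ L₂ ρ τ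

variable {L₁ : List M → Prop} {L₂ : List M → List M → Prop}

theorem dead_of_concatLang (hnil : ∀ ρ, ¬ L₂ ρ []) (h : concatLang L₁ L₂ σ) : Dead L₁ σ := by
  obtain ⟨ρ, τ, h1, rfl, h2⟩ := h
  refine h1.dead_of_prefix h1.1 List.prefix_rfl fun h3 => hnil ρ ?_
  obtain rfl : τ = [] := by simpa using h3
  exact h2

theorem concatLang_append_iff (h : IsLongestPrefix L₁ ρ (ρ ++ τ)) :
    concatLang L₁ L₂ (ρ ++ τ) ↔ L₂ ρ τ := by
  refine ⟨?_, fun h2 => ⟨ρ, τ, h, rfl, h2⟩⟩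
  rintro ⟨ρ', τ', h1, h2, h3⟩
  obtain rfl := h.eq h1
  rwa [List.append_cancel_left h2]

theorem dead_concatLang_append_iff (hL₁ : ConvexLang L₁) (hnil : ∀ ρ, ¬ L₂ ρ [])
    (h : IsLongestPrefix L₁ ρ (ρ ++ τ)) :
    Dead (concatLang L₁ L₂) (ρ ++ τ) ↔ Dead (L₂ ρ) τ := by
  have key : ∀ t, t <+: τ → (concatLang L₁ L₂ (ρ ++ t) ↔ L₂ ρ t) := fun t ht =>
    concatLang_append_iff
      (h.of_prefix (List.prefix_append _ _) (List.prefix_append_right_inj _ |>.2 ht))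
  unfold Dead
  rw [key τ List.prefix_rfl]
  refine and_congr_right fun _ => ⟨?_, ?_⟩
  · rintro ⟨x, hx, hxL⟩
    rcases List.prefix_or_prefix_of_prefix hx (List.prefix_append ρ τ) with h1 | ⟨t, rfl⟩
    -- A member of the concatenation is dead for `L₁`, hence cannot be a prefix of `ρ`, which lies
    -- in `L₁`.
    · exact absurd h.2.1 ((dead_of_concatLang hnil hxL).mono hL₁ h1).1
    · have ht := (List.prefix_append_right_inj _).1 hx
      exact ⟨t, ht, (key t ht).1 hxL⟩
  · rintro ⟨t, ht, htL⟩
    exact ⟨ρ ++ t, (List.prefix_append_right_inj _).2 ht, (key t ht).2 htL⟩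

theorem ConvexLang.concat (hL₁ : ConvexLang L₁) (hL₂ : ∀ ρ, ConvexLang (L₂ ρ))
    (hnil : ∀ ρ, ¬ L₂ ρ []) : ConvexLang (concatLang L₁ L₂) := by
  intro x y z hxy hyz hx hz
  have hd := dead_of_concatLang hnil hx
  obtain ⟨ρ, a, h1, rfl, h2⟩ := hx
  obtain ⟨b, rfl⟩ := hxy
  obtain ⟨c, rfl⟩ := hyz
  have hl := h1.extend hL₁ hd (τ := ρ ++ a ++ b ++ c) ⟨b ++ c, by simp⟩
  have hl' := h1.extend hL₁ hd (τ := ρ ++ a ++ b) ⟨b, by simp⟩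
  simp only [List.append_assoc] at hl hl' hz ⊢
  rw [concatLang_append_iff hl] at hz
  rw [concatLang_append_iff hl']
  exact hL₂ ρ ⟨b, rfl⟩ ⟨c, by simp⟩ h2 hz

/-! #### Exploitation of a set of languages -/

/-- Strings that belong to one of the languages `K p`, `p ∈ S`, and have a prefix in each of
them. -/
def exploitLang (S : Finset M) (K : M → List M → Prop) (σ : List M) : Prop :=
  (∃ p ∈ S, K p σ) ∧ ∀ p ∈ S, ∃ τ, τ <+: σ ∧ K p τ

variable {S : Finset M} {K : M → List M → Prop}

theorem ConvexLang.exploit (hK : ∀ p ∈ S, ConvexLang (K p)) : ConvexLang (exploitLang S K) := by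
  intro x y z hxy hyz hx hz
  obtain ⟨p, hp, hpz⟩ := hz.1
  refine ⟨⟨p, hp, ?_⟩, fun q hq => ?_⟩
  · obtain ⟨τ, hτ, hτK⟩ := hx.2 p hp
    exact hK p hp (hτ.trans hxy) hyz hτK hpz
  · obtain ⟨τ, hτ, hτK⟩ := hx.2 q hq
    exact ⟨τ, hτ.trans hxy, hτK⟩

/-- Exploitation lasts as long as some `p ∈ S` is alive, so there is always a plan to follow. -/
theorem dead_exploitLang_iff (hS : S.Nonempty) :
    Dead (exploitLang S K) σ ↔ ∀ p ∈ S, Dead (K p) σ := by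
  constructor
  · rintro ⟨h1, τ, hτ, hτE⟩ p hp
    have hall : ∀ q ∈ S, ∃ τ, τ <+: σ ∧ K q τ := fun q hq =>
      (hτE.2 q hq).imp fun _ ⟨h2, h3⟩ => ⟨h2.trans hτ, h3⟩
    exact ⟨fun h2 => h1 ⟨⟨p, hp, h2⟩, hall⟩, hall p hp⟩
  · intro h
    refine ⟨fun ⟨⟨p, hp, h1⟩, _⟩ => (h p hp).1 h1, ?_⟩
    -- The longest of the cores is the required member: all the others are prefixes of it.
    obtain ⟨p, hp, hmax⟩ := S.exists_max_image (fun p => (core (K p) σ).length) hS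
    refine ⟨core (K p) σ, core_prefix, ⟨p, hp, (h p hp).isLongestPrefix_core.2.1⟩, fun q hq => ?_⟩
    exact ⟨core (K q) σ, List.prefix_of_prefix_length_le core_prefix core_prefix (hmax q hq),
      (h q hq).isLongestPrefix_core.2.1⟩

end Language

/-! ### Strings with demand vectors -/

section Spec

variable {M : Type u}

/-- The request sequences of the structures described by `P`. -/
def lang (P : List M → (M →₀ ℝ) → Prop) (ρ : List M) : Prop := ∃ v, P ρ v

/-- The request sequences are non-empty, form a convex language, and determine the demand
vectors. -/
structure Good (P : List M → (M →₀ ℝ) → Prop) : Prop where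
  unique : ∀ {ρ v v'}, P ρ v → P ρ v' → v = v'
  convex : ConvexLang (lang P)
  nil : ¬ lang P []

/-- A `P`-structure followed by a structure that depends on its demand vector. -/
def concatSpec (P : List M → (M →₀ ℝ) → Prop) (R : (M →₀ ℝ) → List M → (M →₀ ℝ) → Prop)
    (ρ : List M) (v : M →₀ ℝ) : Prop :=
  ∃ ρ₁ v₁ ρ₂ v₂, P ρ₁ v₁ ∧ R v₁ ρ₂ v₂ ∧ IsLongestPrefix (lang P) ρ₁ (ρ₁ ++ ρ₂) ∧
    ρ = ρ₁ ++ ρ₂ ∧ v = v₁ + v₂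

/-- For each `p ∈ S` a `Q p`-structure, the request sequences forming a prefix chain. -/
def exploitSpec (S : Finset M) (Q : M → List M → (M →₀ ℝ) → Prop)
    (ρ : List M) (v : M →₀ ℝ) : Prop :=
  ∃ (r : M → List M) (s : M → (M →₀ ℝ)), (∀ p ∈ S, Q p (r p) (s p)) ∧ (∃ p ∈ S, ρ = r p) ∧
    (∀ p ∈ S, r p <+: ρ) ∧ (∀ p ∈ S, IsLongestPrefix (lang (Q p)) (r p) ρ) ∧ v = ∑ p ∈ S, s p

theorem lang_concatSpec (P : List M → (M →₀ ℝ) → Prop)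
    (R : (M →₀ ℝ) → List M → (M →₀ ℝ) → Prop) :
    lang (concatSpec P R) = concatLang (lang P) (fun ρ τ => ∃ v, P ρ v ∧ lang (R v) τ) := by
  funext σ
  refine propext ⟨?_, ?_⟩
  · rintro ⟨v, ρ₁, v₁, ρ₂, v₂, h1, h2, h3, rfl, rfl⟩
    exact ⟨ρ₁, ρ₂, h3, rfl, v₁, h1, v₂, h2⟩
  · rintro ⟨ρ₁, ρ₂, h3, rfl, v₁, h1, v₂, h2⟩
    exact ⟨v₁ + v₂, ρ₁, v₁, ρ₂, v₂, h1, h2, h3, rfl, rfl⟩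

theorem lang_exploitSpec (S : Finset M) (Q : M → List M → (M →₀ ℝ) → Prop) :
    lang (exploitSpec S Q) = exploitLang S (fun p => lang (Q p)) := by
  classical
  funext σ
  refine propext ⟨?_, ?_⟩
  · rintro ⟨v, r, s, h1, ⟨p, hp, rfl⟩, h3, h4, rfl⟩
    exact ⟨⟨p, hp, s p, h1 p hp⟩, fun q hq => ⟨r q, h3 q hq, s q, h1 q hq⟩⟩
  · rintro ⟨⟨p, hp, hpσ⟩, h⟩
    have h' : ∀ q, ∃ ρ v, q ∈ S → IsLongestPrefix (lang (Q q)) ρ σ ∧ Q q ρ v := by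
      intro q
      by_cases hq : q ∈ S
      · have hρ := isLongestPrefix_core (h q hq)
        obtain ⟨v, hv⟩ := hρ.2.1
        exact ⟨_, v, fun _ => ⟨hρ, hv⟩⟩
      · exact ⟨[], 0, fun hq' => absurd hq' hq⟩
    choose r s hrs using h'
    exact ⟨_, r, s, fun q hq => (hrs q hq).2, ⟨p, hp, (isLongestPrefix_self hpσ).eq (hrs p hp).1⟩,
      fun q hq => (hrs q hq).1.1, fun q hq => (hrs q hq).1, rfl⟩

/-- The longest-prefix condition forces the cut, and the unique first demand vector fixes which `R
v` follows; uniqueness and convexity then reduce to that single `R v`. -/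
theorem Good.concat {P : List M → (M →₀ ℝ) → Prop} {R : (M →₀ ℝ) → List M → (M →₀ ℝ) → Prop}
    (hP : Good P) (hR : ∀ v, Good (R v)) : Good (concatSpec P R) where
  unique := by
    rintro _ _ _ ⟨ρ₁, v₁, ρ₂, v₂, h1, h2, h3, rfl, rfl⟩ ⟨ρ₁', v₁', ρ₂', v₂', h1', h2', h3', h, rfl⟩
    rw [← h] at h3'
    obtain rfl := h3.eq h3'
    obtain rfl := List.append_cancel_left h
    obtain rfl := hP.unique h1 h1'
    rw [(hR _).unique h2 h2']
  convex := by
    rw [lang_concatSpec]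
    refine hP.convex.concat (fun ρ => ?_) ?_
    · rintro x y z hxy hyz ⟨v, hv, hx⟩ ⟨v', hv', hz⟩
      obtain rfl := hP.unique hv hv'
      exact ⟨v, hv, (hR v).convex hxy hyz hx hz⟩
    · rintro ρ ⟨v, -, h⟩
      exact (hR v).nil h
  nil := by
    rintro ⟨v, ρ₁, v₁, ρ₂, v₂, h1, -, -, h, -⟩
    rw [(List.append_eq_nil_iff.1 h.symm).1] at h1
    exact hP.nil ⟨_, h1⟩

theorem Good.exploit {S : Finset M} {Q : M → List M → (M →₀ ℝ) → Prop}
    (hQ : ∀ p ∈ S, Good (Q p)) : Good (exploitSpec S Q) where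
  unique := by
    rintro ρ _ _ ⟨r, s, h1, -, -, h2, rfl⟩ ⟨r', s', h1', -, -, h2', rfl⟩
    refine Finset.sum_congr rfl fun p hp => (hQ p hp).unique (h1 p hp) ?_
    rw [(h2 p hp).eq (h2' p hp)]
    exact h1' p hp
  convex := by
    rw [lang_exploitSpec]
    exact ConvexLang.exploit fun p hp => (hQ p hp).convex
  nil := by
    rintro ⟨v, r, s, h1, ⟨p, hp, h2⟩, -⟩
    exact (hQ p hp).nil ⟨s p, h2 ▸ h1 p hp⟩

/-- The demand vector of the `P`-structure with a given request sequence. -/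
def demand (P : List M → (M →₀ ℝ) → Prop) (ρ : List M) : M →₀ ℝ :=
  open Classical in if h : ∃ v, P ρ v then h.choose else 0

theorem Good.demand_eq {P : List M → (M →₀ ℝ) → Prop} (hP : Good P) {ρ : List M} {v : M →₀ ℝ}
    (h : P ρ v) : demand P ρ = v := by
  have h' : ∃ v, P ρ v := ⟨v, h⟩
  rw [demand, dif_pos h']
  exact hP.unique h'.choose_spec h

theorem Good.lang_concatSpec {P : List M → (M →₀ ℝ) → Prop}
    {R : (M →₀ ℝ) → List M → (M →₀ ℝ) → Prop} (hP : Good P) :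
    lang (concatSpec P R) = concatLang (lang P) (fun ρ => lang (R (demand P ρ))) := by
  rw [KServer.lang_concatSpec]
  funext σ
  refine propext ⟨?_, ?_⟩
  · rintro ⟨ρ, τ, h1, h2, v, h3, h4⟩
    exact ⟨ρ, τ, h1, h2, by simpa only [hP.demand_eq h3] using h4⟩
  · rintro ⟨ρ, τ, h1, h2, h3⟩
    obtain ⟨v, hv⟩ := h1.2.1
    exact ⟨ρ, τ, h1, h2, v, hv, by rwa [hP.demand_eq hv] at h3⟩

end Spec

/-! ### Phases and multiphases -/

section Phases

variable {M : Type u}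

theorem isSeqOf_zero_iff {P : Finset M → List M → (M →₀ ℝ) → Prop} {H : Finset M} {ρ : List M}
    {v : M →₀ ℝ} : IsSeqOf P 0 H ρ v ↔ ρ = [] ∧ v = 0 := by
  constructor
  · rintro ⟨L, hL, -, -, rfl, rfl⟩
    rw [List.length_eq_zero_iff] at hL
    simp [hL]
  · rintro ⟨rfl, rfl⟩
    exact ⟨[], by simp⟩

theorem isSeqOf_succ (P : Finset M → List M → (M →₀ ℝ) → Prop) (n : ℕ) (H : Finset M) :
    IsSeqOf P (n + 1) H = concatSpec (P H) (fun _ => IsSeqOf P n H) := by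
  funext ρ v
  refine propext ⟨?_, ?_⟩
  · rintro ⟨L, hL, hP, hlong, rfl, rfl⟩
    obtain ⟨Q, L, rfl⟩ := List.exists_cons_of_length_eq_add_one hL
    refine ⟨Q.1, Q.2, (L.map Prod.fst).flatten, (L.map Prod.snd).sum, hP Q (by simp),
      ⟨L, by simpa using hL, fun R hR => hP R (by simp [hR]), fun i hi => ?_, rfl, rfl⟩, ?_,
      by simp, by simp⟩
    · exact hlong (i + 1) (by simpa using hi)
    · exact hlong 0 (by simp)
  · rintro ⟨ρ₁, v₁, ρ₂, v₂, h1, ⟨L, hL, hP, hlong, rfl, rfl⟩, h3, rfl, rfl⟩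
    refine ⟨(ρ₁, v₁) :: L, by simp [hL], ?_, ?_, by simp, by simp⟩
    · intro Q hQ
      rcases List.mem_cons.1 hQ with rfl | hQ
      · exact h1
      · exact hP Q hQ
    · rintro (_ | i) hi
      · exact h3
      · simpa using hlong i (by simpa using hi)

theorem isSeqOf_one (P : Finset M → List M → (M →₀ ℝ) → Prop) (H : Finset M) :
    IsSeqOf P 1 H = P H := by
  rw [isSeqOf_succ]
  funext ρ v
  refine propext ⟨?_, fun h => ?_⟩
  · rintro ⟨ρ₁, v₁, ρ₂, v₂, h1, h2, -, rfl, rfl⟩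
    obtain ⟨rfl, rfl⟩ := isSeqOf_zero_iff.1 h2
    simpa using h1
  · exact ⟨ρ, v, [], 0, h, isSeqOf_zero_iff.2 ⟨rfl, rfl⟩, by simpa using isLongestPrefix_self ⟨v, h⟩,
      by simp, by simp⟩

/-- The induction starts at one because for `n = 0` the empty string is a member. -/
theorem Good.isSeqOf {P : Finset M → List M → (M →₀ ℝ) → Prop} (hP : ∀ H, Good (P H)) {n : ℕ}
    (hn : 1 ≤ n) (H : Finset M) : Good (IsSeqOf P n H) := by
  induction n, hn using Nat.le_induction with
  | base => rw [isSeqOf_one]; exact hP H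
  | succ n _ ih => rw [isSeqOf_succ]; exact (hP H).concat fun _ => ih

variable [LinearOrder M]

theorem isPhase_add_two (w : ℕ → ℝ) (l : ℕ) (H : Finset M) :
    IsPhase w (l + 2) H = concatSpec (IsMultiphase w (l + 1) H)
      (fun v => exploitSpec (top (d (l + 2) - 1) v)
        (fun p => IsMultiphase w (l + 1) (insert p H))) := by
  funext ρ v
  refine propext ⟨?_, ?_⟩
  · rintro ⟨ρ0, v0, S, r, s, ρ', h1, rfl, h2, h3, h4, h5, h6, rfl, rfl⟩
    exact ⟨ρ0, v0, ρ', _, h1, ⟨r, s, h2, h3, h4, h6, rfl⟩, h5, rfl, rfl⟩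
  · rintro ⟨ρ0, v0, ρ', _, h1, ⟨r, s, h2, h3, h4, h6, rfl⟩, h5, rfl, rfl⟩
    exact ⟨ρ0, v0, _, r, s, ρ', h1, rfl, h2, h3, h4, h5, h6, rfl, rfl⟩

theorem good_isPhase_one (w : ℕ → ℝ) (H : Finset M) : Good (IsPhase w 1 H) where
  unique := by
    rintro ρ _ _ ⟨p, hp, hpρ, -, rfl⟩ ⟨q, -, -, hq, rfl⟩
    rw [(hq p hpρ).resolve_left hp]
  convex := by
    rintro x y z hxy hyz ⟨_, p, hp, hpx, -, -⟩ ⟨_, q, hq, -, hz, -⟩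
    have hpy := hxy.subset hpx
    obtain rfl := (hz p (hyz.subset hpy)).resolve_left hp
    exact ⟨_, p, hp, hpy, fun a ha => hz a (hyz.subset ha), rfl⟩
  nil := by
    rintro ⟨_, p, -, hp, -⟩
    simp at hp

theorem good_isPhase (w : ℕ → ℝ) (l : ℕ) (hl : 1 ≤ l) (hr : ∀ i, 1 ≤ i → i < l → 1 ≤ ratio w i)
    (H : Finset M) : Good (IsPhase w l H) := by
  induction l, hl using Nat.le_induction generalizing H with
  | base => exact good_isPhase_one w H
  | succ l hl ih =>
    obtain ⟨l, rfl⟩ := Nat.exists_eq_add_of_le' hl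
    have hm : ∀ H, Good (IsMultiphase w (l + 1) H : List M → (M →₀ ℝ) → Prop) :=
      Good.isSeqOf (ih fun i h1 h2 => hr i h1 (by omega)) (hr _ hl (by omega))
    rw [isPhase_add_two]
    exact (hm H).concat fun v => Good.exploit fun p _ => hm _

/-! ### Size and non-emptiness of the critical set -/

theorem card_top_le (n : ℕ) (v : M →₀ ℝ) : (top n v).card ≤ n := by
  rcases (top n v).eq_empty_or_nonempty with h | hne
  · simp [h]
  obtain ⟨p, hp, hmax⟩ := (top n v).exists_max_image (fun q => toLex (-(v q), q)) hne
  have hsub : (((top n v).erase p : Finset M) : Set M) ⊆ {q | Precedes v q p} := by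
    intro q hq
    have hq' := Finset.mem_erase.1 (Finset.mem_coe.1 hq)
    have h1 := hmax q hq'.2
    rw [Prod.Lex.toLex_le_toLex] at h1
    rcases h1 with h1 | ⟨h1, h2⟩
    · exact Or.inl (by simpa using h1)
    · exact Or.inr ⟨by simpa using h1, lt_of_le_of_ne h2 hq'.1⟩
  have h2 : (((top n v).erase p : Finset M) : Set M).encard < n :=
    lt_of_le_of_lt (Set.encard_le_encard hsub) (by simpa [top, topSet] using hp)
  rw [Set.encard_coe_eq_coe_finsetCard, Finset.card_erase_of_mem hp, Nat.cast_lt] at h2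
  omega

/-- The finitely many values of `v` have a maximum. It may be attained at infinitely many points
(when it is zero), and the well-order supplies the least of them, which nothing precedes. -/
theorem top_nonempty [WellFoundedLT M] [Nonempty M] {n : ℕ} (hn : 1 ≤ n) (v : M →₀ ℝ) :
    (top n v).Nonempty := by
  obtain ⟨_, ⟨a, rfl⟩, ha⟩ := Set.exists_max_image (Set.range v) id v.finite_range
    (Set.range_nonempty v)
  obtain ⟨p, hp, hmin⟩ := WellFounded.has_min (wellFounded_lt (α := M)) {p | v p = v a} ⟨a, rfl⟩
  refine ⟨p, ?_⟩
  have h0 : {q | Precedes v q p} = ∅ := by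
    refine Set.eq_empty_of_forall_notMem fun q hq => ?_
    rcases hq with h1 | ⟨h1, h2⟩
    · exact absurd (ha (v q) ⟨q, rfl⟩) (not_le.2 (by simpa [hp.symm] using h1))
    · exact hmin q (h1.trans hp) h2
  simp only [top, topSet, Set.Finite.mem_toFinset, Set.mem_ofPred_eq, h0, Set.encard_empty]
  exact_mod_cast hn

end Phases

/-! ### Costs of plans -/

section Cost

variable {k : ℕ} {M : Type u} [DecidableEq M] {w : ℕ → ℝ}

theorem moveCost_nonneg (hw : ∀ j : Fin k, 0 ≤ w (j + 1)) (C C' : Config k M) :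
    0 ≤ moveCost w C C' :=
  Finset.sum_nonneg fun j _ => by split_ifs <;> simp [hw j]

@[simp]
theorem moveCost_self (C : Config k M) : moveCost w C C = 0 := by simp [moveCost]

theorem moveCost_le_of_eq_heavy (hw : ∀ j : Fin k, 0 ≤ w (j + 1)) {l : ℕ} (hl : l ≤ k)
    {C C' : Config k M} (h : ∀ j : Fin k, l ≤ (j : ℕ) → C j = C' j) :
    moveCost w C C' ≤ ∑ i ∈ Finset.range l, w (i + 1) := by
  have h1 : moveCost w C C' ≤ ∑ j : Fin k, if (j : ℕ) < l then w (j + 1) else 0 := by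
    refine Finset.sum_le_sum fun j _ => ?_
    by_cases hj : (j : ℕ) < l
    · rw [if_pos hj]
      split_ifs <;> simp [hw j]
    · rw [if_neg (not_not.2 (h j (not_lt.1 hj))), if_neg hj]
  refine h1.trans_eq ?_
  rw [Fin.sum_univ_eq_sum_range (fun i => if i < l then w (i + 1) else 0) k, ← Finset.sum_filter]
  congr 1
  ext i
  simp only [Finset.mem_filter, Finset.mem_range]
  omega

/-- The cost of moving through the configurations `g τ`, where `τ` runs over the prefixes of a
string. -/
def pathCost (w : ℕ → ℝ) : (List M → Config k M) → List M → ℝ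
  | _, [] => 0
  | g, x :: σ => moveCost w (g []) (g [x]) + pathCost w (fun t => g (x :: t)) σ

@[simp]
theorem pathCost_nil (g : List M → Config k M) : pathCost w g [] = 0 := rfl

theorem pathCost_append (g : List M → Config k M) (σ τ : List M) :
    pathCost w g (σ ++ τ) = pathCost w g σ + pathCost w (fun t => g (σ ++ t)) τ := by
  induction σ generalizing g with
  | nil => simp
  | cons x σ ih => simp [pathCost, ih, add_assoc]

theorem pathCost_concat (g : List M → Config k M) (σ : List M) (x : M) :
    pathCost w g (σ ++ [x]) = pathCost w g σ + moveCost w (g σ) (g (σ ++ [x])) := by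
  simp [pathCost_append, pathCost]

theorem pathCost_nonneg (hw : ∀ j : Fin k, 0 ≤ w (j + 1)) (g : List M → Config k M)
    (σ : List M) : 0 ≤ pathCost w g σ := by
  induction σ generalizing g with
  | nil => rfl
  | cons x σ ih => exact add_nonneg (moveCost_nonneg hw _ _) (ih _)

theorem pathCost_mono (hw : ∀ j : Fin k, 0 ≤ w (j + 1)) (g : List M → Config k M)
    {σ τ : List M} (h : σ <+: τ) : pathCost w g σ ≤ pathCost w g τ := by
  obtain ⟨ρ, rfl⟩ := h
  rw [pathCost_append]
  exact le_add_of_nonneg_right (pathCost_nonneg hw _ _)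

theorem pathCost_congr {g g' : List M → Config k M} {σ : List M}
    (h : ∀ τ, τ <+: σ → g τ = g' τ) : pathCost w g σ = pathCost w g' σ := by
  induction σ generalizing g g' with
  | nil => rfl
  | cons x σ ih =>
    rw [pathCost, pathCost, h [] List.nil_prefix, h [x] ⟨σ, rfl⟩,
      ih fun τ hτ => h (x :: τ) (List.cons_prefix_cons.2 ⟨rfl, hτ⟩)]

theorem solutionCost_concat (C : Config k M) (t : List (Config k M)) (C' : Config k M) :
    solutionCost w C (t ++ [C']) =
      solutionCost w C t + moveCost w ((C :: t).getLast (by simp)) C' := by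
  induction t generalizing C with
  | nil => simp [solutionCost]
  | cons D t ih =>
    rw [List.cons_append, solutionCost, ih, solutionCost, add_assoc]
    simp

end Cost

/-! ### Plans -/

section Plan

variable {k : ℕ} {M : Type u} [DecidableEq M] {ι : Type v}

/-- A randomized rule that determines, for every string that is not dead for the language `K i`, the
configuration after serving this string. It serves all requests, moves only the lightest `l`
servers, and has expected cost at most `b`. -/
structure IsPlan (w : ℕ → ℝ) (l : ℕ) (D : ι → Config k M → Prop) (K : ι → List M → Prop)
    (b : ENNReal) {Seed : Type} (law : PMF Seed)
    (g : Seed → ι → Config k M → List M → Config k M) : Prop where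
  nil : ∀ ω i C, D i C → g ω i C [] = C
  serves : ∀ ω i C, D i C → ∀ σ x, ¬ Dead (K i) (σ ++ [x]) → ∃ j, g ω i C (σ ++ [x]) j = x
  light : ∀ ω i C, D i C → ∀ σ, ¬ Dead (K i) σ → ∀ j : Fin k, l ≤ (j : ℕ) → g ω i C σ j = C j
  cost : ∀ i C, D i C → ∀ σ, ¬ Dead (K i) σ →
    ∑' ω, law ω * ENNReal.ofReal (pathCost w (g ω i C) σ) ≤ b

/-- A plan exists. -/
def HasPlan (w : ℕ → ℝ) (l : ℕ) (D : ι → Config k M → Prop) (K : ι → List M → Prop)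
    (b : ENNReal) : Prop :=
  ∃ (Seed : Type) (law : PMF Seed) (g : Seed → ι → Config k M → List M → Config k M),
    IsPlan w l D K b law g

theorem HasPlan.mono {w : ℕ → ℝ} {l : ℕ} {D : ι → Config k M → Prop} {K : ι → List M → Prop}
    {b b' : ENNReal} (h : HasPlan w l D K b) (hb : b ≤ b') : HasPlan w l D K b' := by
  obtain ⟨Seed, law, g, h⟩ := h
  exact ⟨Seed, law, g, h.nil, h.serves, h.light, fun i C hC σ hσ => (h.cost i C hC σ hσ).trans hb⟩

end Plan

/-! ### Plans and strategies -/

section Strategy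

variable {k : ℕ} {M : Type u}

/-- The admissible initial inputs: at most `k - l` points, all covered by the servers heavier than
the lightest `l`. -/
def Covered (l : ℕ) (H : Finset M) (C : Config k M) : Prop :=
  H.card ≤ k - l ∧ ∀ p ∈ H, ∃ j : Fin k, l ≤ (j : ℕ) ∧ C j = p

theorem Covered.congr {l : ℕ} {H : Finset M} {C C' : Config k M} (h : Covered l H C)
    (h' : ∀ j : Fin k, l ≤ (j : ℕ) → C' j = C j) : Covered l H C' :=
  ⟨h.1, fun p hp => (h.2 p hp).imp fun j hj => ⟨hj.1, (h' j hj.1).trans hj.2⟩⟩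

theorem Covered.of_succ {l : ℕ} {H : Finset M} {C : Config k M} (h : Covered (l + 1) H C) :
    Covered l H C :=
  ⟨h.1.trans (by omega), fun p hp => (h.2 p hp).imp fun j hj => ⟨by omega, hj.2⟩⟩

theorem runFrom_append (A : OnlineAlg k M) (past ρ τ : List M)
    (h : (runFrom A past ρ).result = none) :
    runFrom A past (ρ ++ τ) =
      ⟨(runFrom A past ρ).served ++ (runFrom A (past ++ ρ) τ).served,
        (runFrom A past ρ).configs ++ (runFrom A (past ++ ρ) τ).configs,
        (runFrom A (past ++ ρ) τ).result⟩ := by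
  induction ρ generalizing past with
  | nil => simp [runFrom]
  | cons x ρ ih =>
    rw [List.cons_append, runFrom, runFrom]
    rw [runFrom] at h
    cases hA : A past x with
    | inr v => simp [hA] at h
    | inl C =>
      simp only [hA] at h ⊢
      rw [ih _ h]
      simp

/-- The deterministic online algorithm that follows a plan until the requests become dead. -/
def planAlg (P : List M → (M →₀ ℝ) → Prop) (g : List M → Config k M) : OnlineAlg k M :=
  fun past x => open Classical in
    if Dead (lang P) (past ++ [x]) then Sum.inr (demand P past) else Sum.inl (g (past ++ [x]))

/-- The configurations visited by a plan. -/
def visited (g : List M → Config k M) : List M → List (Config k M)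
  | [] => []
  | x :: σ => g [x] :: visited (fun t => g (x :: t)) σ

theorem visited_concat (g : List M → Config k M) (σ : List M) (x : M) :
    visited g (σ ++ [x]) = visited g σ ++ [g (σ ++ [x])] := by
  induction σ generalizing g with
  | nil => rfl
  | cons y σ ih => simp [visited, ih]

theorem solutionCost_visited [DecidableEq M] {w : ℕ → ℝ} (g : List M → Config k M)
    (σ : List M) : solutionCost w (g []) (visited g σ) = pathCost w g σ := by
  induction σ generalizing g with
  | nil => rfl
  | cons x σ ih => rw [visited, solutionCost, pathCost, ← ih]

variable {P : List M → (M →₀ ℝ) → Prop} {g : List M → Config k M}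

theorem run_planAlg_of_not_dead (hP : Good P) {σ : List M} (h : ¬ Dead (lang P) σ) :
    run (planAlg P g) σ = ⟨σ, visited g σ, none⟩ := by
  induction σ using List.reverseRecOn with
  | nil => rfl
  | append_singleton σ x ih =>
    have ih := ih fun h' => h (h'.mono hP.convex (List.prefix_append _ _))
    unfold run at ih ⊢
    rw [runFrom_append _ _ _ _ (by rw [ih]), ih, visited_concat]
    simp [runFrom, planAlg, h]

theorem run_planAlg_of_dead (hP : Good P) {σ : List M} (h : Dead (lang P) σ) :
    run (planAlg P g) σ =
      ⟨core (lang P) σ, visited g (core (lang P) σ), some (demand P (core (lang P) σ))⟩ := by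
  obtain ⟨τ, hτ⟩ := core_prefix (L := lang P) (σ := σ)
  have hc : ¬ Dead (lang P) (core (lang P) σ) := not_dead_core
  generalize hρ : core (lang P) σ = ρ at hτ hc
  cases τ with
  | nil =>
    rw [List.append_nil] at hτ
    exact absurd (hτ ▸ h) hc
  | cons x τ =>
    -- The core is the longest non-dead prefix, so the next request kills it and the algorithm stops
    -- exactly there.
    have hx : Dead (lang P) (ρ ++ [x]) := by
      by_contra hx
      have := (prefix_core (σ := σ) ⟨τ, by rw [← hτ]; simp⟩ hx).length_le
      rw [hρ] at this
      simp at this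
    have hrun := run_planAlg_of_not_dead (g := g) hP hc
    unfold run at hrun ⊢
    rw [← hτ, runFrom_append _ _ _ _ (by rw [hrun]), hrun]
    simp [runFrom, planAlg, hx]

theorem run_planAlg (hP : Good P) (σ : List M) :
    (run (planAlg P g) σ).served = core (lang P) σ ∧
      (run (planAlg P g) σ).configs = visited g (core (lang P) σ) := by
  by_cases h : Dead (lang P) σ
  · simp [run_planAlg_of_dead hP h]
  · simp [run_planAlg_of_not_dead hP h, core_eq_self h]

theorem serves_visited {σ : List M} (h : ∀ τ x, τ ++ [x] <+: σ → ∃ j, g (τ ++ [x]) j = x) :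
    Serves σ (visited g σ) := by
  induction σ generalizing g with
  | nil => exact List.Forall₂.nil
  | cons y σ ih =>
    refine List.Forall₂.cons (h [] y ⟨σ, rfl⟩) (ih fun τ x hτ => h (y :: τ) x ?_)
    exact List.cons_prefix_cons.2 ⟨rfl, hτ⟩

theorem exists_of_mem_visited {σ : List M} {C : Config k M} (h : C ∈ visited g σ) :
    ∃ τ, τ <+: σ ∧ C = g τ := by
  induction σ using List.reverseRecOn with
  | nil => simp [visited] at h
  | append_singleton σ x ih =>
    rw [visited_concat, List.mem_append, List.mem_singleton] at h
    rcases h with h | h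
    · exact (ih h).imp fun τ hτ => ⟨hτ.1.trans (List.prefix_append _ _), hτ.2⟩
    · exact ⟨_, List.prefix_rfl, h⟩

theorem HasPlan.exists_strategy [DecidableEq M] {w : ℕ → ℝ} {l : ℕ}
    {P : Finset M → List M → (M →₀ ℝ) → Prop} {b : ℝ} (hP : ∀ H, Good (P H))
    (h : HasPlan w l (Covered (k := k) l) (fun H => lang (P H)) (ENNReal.ofReal b)) :
    ∃ A : RandomizedAlg k M, IsStrategy w l P b A := by
  obtain ⟨Seed, law, g, h⟩ := h
  have halive : ∀ {H : Finset M} {σ τ : List M}, τ <+: core (lang (P H)) σ →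
      ¬ Dead (lang (P H)) τ := fun hτ hd => not_dead_core (hd.mono (hP _).convex hτ)
  refine ⟨⟨Seed, law, fun ω H C => planAlg (P H) (g ω H C)⟩, ?_, ?_, ?_, ?_, ?_⟩
  · intro H C h1 h2 ρ ω
    rw [(run_planAlg (hP H) ρ).1, (run_planAlg (hP H) ρ).2]
    exact serves_visited fun τ x hτ => h.serves ω H C ⟨h1, h2⟩ τ x (halive hτ)
  · intro H C h1 h2 ρ ω C' hC' j hj
    rw [(run_planAlg (hP H) ρ).2] at hC'
    obtain ⟨τ, hτ, rfl⟩ := exists_of_mem_visited hC'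
    exact h.light ω H C ⟨h1, h2⟩ τ (halive hτ) j hj
  · intro H C h1 h2 ρ ω hρ ρs hρs
    have hc := IsLongestPrefix.core_eq hρs
    rw [run_planAlg_of_dead (hP H) ⟨hρ, ρs, hρs.1, hρs.2.1⟩]
    refine ⟨hc, fun v hv => ?_⟩
    change some (demand (P H) (core (IsRequestSeq P H) ρ)) = some v
    rw [hc, (hP H).demand_eq hv]
  · intro H C h1 h2 ρ ω hρ
    rw [run_planAlg_of_not_dead (hP H) hρ]
    exact ⟨rfl, rfl⟩
  · intro H C h1 h2 ρ
    refine le_trans (le_of_eq (tsum_congr fun ω => ?_))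
      (h.cost H C ⟨h1, h2⟩ (core (lang (P H)) ρ) not_dead_core)
    rw [(run_planAlg (hP H) ρ).2]
    change law ω * ENNReal.ofReal (solutionCost w C (visited (g ω H C) _)) = _
    rw [← solutionCost_visited, h.nil ω H C ⟨h1, h2⟩]

theorem IsStrategy.hasPlan [DecidableEq M] {w : ℕ → ℝ} {l : ℕ}
    {P : Finset M → List M → (M →₀ ℝ) → Prop} {b : ℝ} (hP : ∀ H, Good (P H))
    {A : RandomizedAlg k M} (hA : IsStrategy w l P b A) :
    HasPlan w l (Covered (k := k) l) (fun H => lang (P H)) (ENNReal.ofReal b) := by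
  have hrun : ∀ ω H C, Covered l H C → ∀ σ, ¬ Dead (lang (P H)) σ →
      (run (A.alg ω H C) σ).served = σ ∧ (run (A.alg ω H C) σ).result = none :=
    fun ω H C hC σ hσ => hA.waits H C hC.1 hC.2 σ ω hσ
  -- The plan records the last configuration of the run; the prepended `C` covers the empty run.
  let g : A.Seed → Finset M → Config k M → List M → Config k M := fun ω H C σ =>
    (C :: (run (A.alg ω H C) σ).configs).getLast (by simp)
  have hstep : ∀ ω H C, Covered l H C → ∀ σ x, ¬ Dead (lang (P H)) (σ ++ [x]) →
      (run (A.alg ω H C) (σ ++ [x])).configs =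
        (run (A.alg ω H C) σ).configs ++ [g ω H C (σ ++ [x])] := by
    intro ω H C hC σ x hx
    have hσ : ¬ Dead (lang (P H)) σ := fun h => hx (h.mono (hP H).convex (List.prefix_append _ _))
    have h1 := hrun ω H C hC σ hσ
    have h2 := hrun ω H C hC _ hx
    have h3 := runFrom_append (A.alg ω H C) [] σ [x] h1.2
    change run (A.alg ω H C) (σ ++ [x]) = _ at h3
    have h4 : ∃ C', (run (A.alg ω H C) (σ ++ [x])).configs =
        (run (A.alg ω H C) σ).configs ++ [C'] := by
      cases h5 : A.alg ω H C σ x with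
      | inr v =>
        rw [h3] at h2
        simp [runFrom, h5] at h2
      | inl C' =>
        refine ⟨C', ?_⟩
        rw [h3]
        simp [runFrom, h5, run]
    obtain ⟨C', h4⟩ := h4
    simp [g, h4]
  refine ⟨A.Seed, A.law, g, fun ω H C _ => by simp [g, run, runFrom], ?_, ?_, ?_⟩
  · intro ω H C hC σ x hx
    have h1 := hA.serves H C hC.1 hC.2 (σ ++ [x]) ω
    rw [hstep ω H C hC σ x hx, (hrun ω H C hC _ hx).1] at h1
    have h2 := List.rel_reverse h1
    simp only [List.reverse_append, List.reverse_singleton, List.singleton_append,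
      List.forall₂_cons] at h2
    exact h2.1
  · intro ω H C hC σ hσ j hj
    rcases List.mem_cons.1 (List.getLast_mem (List.cons_ne_nil C
      (run (A.alg ω H C) σ).configs)) with h1 | h1
    · exact congrFun h1 j
    · exact hA.light H C hC.1 hC.2 σ ω _ h1 j hj
  · intro H C hC σ hσ
    refine le_trans (le_of_eq (tsum_congr fun ω => ?_)) (hA.cost H C hC.1 hC.2 σ)
    congr 2
    induction σ using List.reverseRecOn with
    | nil => simp [run, runFrom, solutionCost]
    | append_singleton σ x ih =>
      rw [pathCost_concat, hstep ω H C hC σ x hσ, solutionCost_concat,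
        ih fun h => hσ (h.mono (hP H).convex (List.prefix_append _ _))]

end Strategy

/-! ### Independent seeds -/

section Product

/-- The law of a pair of independent seeds. -/
def prodLaw {α β : Type} (p : PMF α) (q : PMF β) : PMF (α × β) :=
  ⟨fun x => p x.1 * q x.2, by
    rw [ENNReal.summable.hasSum_iff, ENNReal.tsum_prod']
    simp [ENNReal.tsum_mul_left]⟩

theorem tsum_prodLaw {α β : Type} (p : PMF α) (q : PMF β) (f : α × β → ENNReal) :
    ∑' x, prodLaw p q x * f x = ∑' a, p a * ∑' b, q b * f (a, b) := by
  rw [ENNReal.tsum_prod']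
  refine tsum_congr fun a => ?_
  rw [← ENNReal.tsum_mul_left]
  exact tsum_congr fun b => mul_assoc _ _ _

end Product

/-! ### Composition of plans -/

section Concat

variable {k : ℕ} {M : Type u} [DecidableEq M] {ι ι₂ : Type*}

/-- Follow the plan `g₁` as long as possible and then the plan `g₂` with a new parameter. -/
def concatPlan {A B : Type} (K₁ : ι → List M → Prop) (t : ι → List M → ι₂)
    (g₁ : A → ι → Config k M → List M → Config k M)
    (g₂ : B → ι₂ → Config k M → List M → Config k M) (ω : A × B) (i : ι) (C : Config k M)
    (σ : List M) : Config k M :=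
  open Classical in
  if Dead (K₁ i) σ then
    g₂ ω.2 (t i (core (K₁ i) σ)) (g₁ ω.1 i C (core (K₁ i) σ)) (σ.drop (core (K₁ i) σ).length)
  else g₁ ω.1 i C σ

/-- For a fixed first seed, the second plan starts from a fixed admissible configuration, so its
conditional expected cost is at most `b₂`; then one averages over the first seed. -/
theorem HasPlan.concat {w : ℕ → ℝ} (hw : ∀ j : Fin k, 0 ≤ w (j + 1)) {l₁ l₂ : ℕ} (hl : l₁ ≤ l₂)
    {D₁ : ι → Config k M → Prop} {K₁ : ι → List M → Prop} {b₁ : ENNReal}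
    {D₂ : ι₂ → Config k M → Prop} {K₂ : ι₂ → List M → Prop} {b₂ : ENNReal}
    (h₁ : HasPlan w l₁ D₁ K₁ b₁) (h₂ : HasPlan w l₂ D₂ K₂ b₂)
    (hconv : ∀ i, ConvexLang (K₁ i)) (hnil : ∀ i, ¬ K₂ i []) (t : ι → List M → ι₂)
    (ht : ∀ i C ρ C', D₁ i C → K₁ i ρ → (∀ j : Fin k, l₁ ≤ (j : ℕ) → C' j = C j) →
      D₂ (t i ρ) C') :
    HasPlan w l₂ D₁ (fun i => concatLang (K₁ i) (fun ρ => K₂ (t i ρ))) (b₁ + b₂) := by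
  obtain ⟨A, law₁, g₁, h₁⟩ := h₁
  obtain ⟨B, law₂, g₂, h₂⟩ := h₂
  have hsplit : ∀ i σ, Dead (K₁ i) σ → ¬ Dead (concatLang (K₁ i) (fun ρ => K₂ (t i ρ))) σ →
      ∃ τ, τ ≠ [] ∧ σ = core (K₁ i) σ ++ τ ∧ IsLongestPrefix (K₁ i) (core (K₁ i) σ) σ ∧
        ¬ Dead (K₂ (t i (core (K₁ i) σ))) τ := by
    intro i σ hd hσ
    have hlong := hd.isLongestPrefix_core
    obtain ⟨τ, hτ⟩ := hlong.1
    refine ⟨τ, ?_, hτ.symm, hlong, ?_⟩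
    · rintro rfl
      rw [List.append_nil] at hτ
      exact not_dead_core (L := K₁ i) (σ := σ) (hτ.symm ▸ hd)
    · generalize core (K₁ i) σ = ρ at *
      subst hτ
      rwa [dead_concatLang_append_iff (L₂ := fun ρ => K₂ (t i ρ)) (hconv i) (fun ρ => hnil _)
        hlong] at hσ
  have hD : ∀ ω i C ρ, D₁ i C → K₁ i ρ → D₂ (t i ρ) (g₁ ω i C ρ) := fun ω i C ρ hC hρ =>
    ht i C ρ _ hC hρ fun j hj => h₁.light ω i C hC ρ (not_dead_of_mem hρ) j hj
  have halive : ∀ (ω : A × B) i C σ, ¬ Dead (K₁ i) σ →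
      concatPlan K₁ t g₁ g₂ ω i C σ = g₁ ω.1 i C σ := fun ω i C σ h => if_neg h
  have hdead : ∀ (ω : A × B) i C ρ τ, Dead (K₁ i) (ρ ++ τ) →
      IsLongestPrefix (K₁ i) ρ (ρ ++ τ) →
      concatPlan K₁ t g₁ g₂ ω i C (ρ ++ τ) = g₂ ω.2 (t i ρ) (g₁ ω.1 i C ρ) τ := by
    intro ω i C ρ τ h hρ
    rw [concatPlan, if_pos h, hρ.core_eq, List.drop_left]
  refine ⟨A × B, prodLaw law₁ law₂, concatPlan K₁ t g₁ g₂, ?_, ?_, ?_, ?_⟩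
  · intro ω i C hC
    rw [halive _ _ _ _ not_dead_nil]
    exact h₁.nil _ _ _ hC
  · intro ω i C hC σ x hx
    by_cases hd : Dead (K₁ i) (σ ++ [x])
    · obtain ⟨τ, hne, hτ, hlong, hτd⟩ := hsplit i _ hd hx
      generalize core (K₁ i) (σ ++ [x]) = ρ at *
      rw [hτ] at hlong hd ⊢
      rw [hdead _ _ _ _ _ hd hlong]
      obtain ⟨τ, y, rfl⟩ := List.eq_nil_or_concat' τ |>.resolve_left hne
      rw [← List.append_assoc] at hτ
      obtain rfl : x = y := by simpa using (List.append_inj_right' hτ rfl)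
      exact h₂.serves _ _ _ (hD _ _ _ _ hC hlong.2.1) _ _ hτd
    · rw [halive _ _ _ _ hd]
      exact h₁.serves _ _ _ hC _ _ hd
  · intro ω i C hC σ hσ j hj
    by_cases hd : Dead (K₁ i) σ
    · obtain ⟨τ, -, hτ, hlong, hτd⟩ := hsplit i _ hd hσ
      generalize core (K₁ i) σ = ρ at *
      subst hτ
      rw [hdead _ _ _ _ _ hd hlong, h₂.light _ _ _ (hD _ _ _ _ hC hlong.2.1) _ hτd j hj]
      exact h₁.light _ _ _ hC _ (not_dead_of_mem hlong.2.1) j (hl.trans hj)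
    · rw [halive _ _ _ _ hd]
      exact h₁.light _ _ _ hC _ hd j (hl.trans hj)
  · intro i C hC σ hσ
    rw [tsum_prodLaw]
    by_cases hd : Dead (K₁ i) σ
    · obtain ⟨τ, -, hτ, hlong, hτd⟩ := hsplit i _ hd hσ
      generalize core (K₁ i) σ = ρ at *
      subst hτ
      have hρ := not_dead_of_mem hlong.2.1
      have hcost : ∀ a b, pathCost w (concatPlan K₁ t g₁ g₂ (a, b) i C) (ρ ++ τ) =
          pathCost w (g₁ a i C) ρ + pathCost w (g₂ b (t i ρ) (g₁ a i C ρ)) τ := by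
        intro a b
        rw [pathCost_append]
        congr 1
        · refine pathCost_congr fun x hx => halive _ _ _ _ fun h => hρ (h.mono (hconv i) hx)
        · refine pathCost_congr fun x hx => ?_
          have hx' : ρ ++ x <+: ρ ++ τ := (List.prefix_append_right_inj _).2 hx
          have hlong' := hlong.of_prefix (List.prefix_append ρ x) hx'
          -- At the cut itself the configuration still comes from `g₁`; it agrees with the start of
          -- `g₂`, so no extra move occurs.
          rcases eq_or_ne x [] with rfl | hne
          · rw [List.append_nil, halive _ _ _ _ hρ, h₂.nil _ _ _ (hD _ _ _ _ hC hlong.2.1)]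
          · exact hdead _ _ _ _ _
              (hlong.dead_of_prefix (List.prefix_append ρ x) hx' (by simpa using hne)) hlong'
      have hle : ∀ a, ∑' b, law₂ b *
          ENNReal.ofReal (pathCost w (concatPlan K₁ t g₁ g₂ (a, b) i C) (ρ ++ τ)) ≤
          ENNReal.ofReal (pathCost w (g₁ a i C) ρ) + b₂ := by
        intro a
        simp_rw [hcost, ENNReal.ofReal_add (pathCost_nonneg hw _ _) (pathCost_nonneg hw _ _),
          mul_add]
        rw [ENNReal.tsum_add, ENNReal.tsum_mul_right, PMF.tsum_coe, one_mul]
        gcongr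
        exact h₂.cost _ _ (hD _ _ _ _ hC hlong.2.1) _ hτd
      calc _ ≤ ∑' a, law₁ a * (ENNReal.ofReal (pathCost w (g₁ a i C) ρ) + b₂) :=
            ENNReal.tsum_le_tsum fun a => mul_le_mul_right (hle a) _
        _ ≤ b₁ + b₂ := by
            simp_rw [mul_add]
            rw [ENNReal.tsum_add, ENNReal.tsum_mul_right, PMF.tsum_coe, one_mul]
            gcongr
            exact h₁.cost _ _ hC _ hρ
    · refine le_trans (le_of_eq ?_) ((h₁.cost i C hC σ hd).trans le_self_add)
      refine tsum_congr fun a => ?_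
      rw [← one_mul (ENNReal.ofReal (pathCost w (g₁ a i C) σ)), ← PMF.tsum_coe law₂,
        ← ENNReal.tsum_mul_right]
      congr 1
      refine tsum_congr fun b => ?_
      congr 2
      exact pathCost_congr fun x hx => halive _ _ _ _ fun h => hd (h.mono (hconv i) hx)

theorem HasPlan.isSeqOf {w : ℕ → ℝ} (hw : ∀ j : Fin k, 0 ≤ w (j + 1)) {l : ℕ}
    {P : Finset M → List M → (M →₀ ℝ) → Prop} (hP : ∀ H, Good (P H)) {b : ENNReal}
    (h : HasPlan w l (Covered (k := k) l) (fun H => lang (P H)) b) {n : ℕ} (hn : 1 ≤ n) :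
    HasPlan w l (Covered (k := k) l) (fun H => lang (IsSeqOf P n H)) (n * b) := by
  induction n, hn using Nat.le_induction with
  | base =>
    simp_rw [isSeqOf_one]
    simpa using h
  | succ n hn ih =>
    have h' := h.concat hw le_rfl ih (fun H => (hP H).convex) (fun H => (Good.isSeqOf hP hn H).nil)
      (fun H _ => H) (fun H C ρ C' hC _ hC' => hC.congr hC')
    simp_rw [isSeqOf_succ, (hP _).lang_concatSpec]
    rwa [Nat.cast_add, Nat.cast_one, add_mul, one_mul, add_comm]

end Concat

/-! ### The least element of a random order -/

section RandomOrder

/-- Independence: whether a point is followed depends on the random order only, the cost of its plan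
on the other seed only, so expectations factor termwise. -/
theorem tsum_mul_tsum_mul_sum {α β γ : Type*} (p : α → ENNReal) (q : β → ENNReal) (S : Finset γ)
    (f : γ → β → ENNReal) (c : γ → α → ENNReal) :
    ∑' a, p a * ∑' b, q b * ∑ x ∈ S, f x b * c x a =
      ∑ x ∈ S, (∑' b, q b * f x b) * ∑' a, p a * c x a := by
  calc _ = ∑' a, ∑ x ∈ S, (∑' b, q b * f x b) * (p a * c x a) := by
        refine tsum_congr fun a => ?_
        simp_rw [Finset.mul_sum]
        rw [Summable.tsum_finsetSum fun _ _ => ENNReal.summable, Finset.mul_sum]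
        refine Finset.sum_congr rfl fun x _ => ?_
        simp_rw [← mul_assoc (q _), ENNReal.tsum_mul_right]
        ring
    _ = _ := by
        rw [Summable.tsum_finsetSum fun _ _ => ENNReal.summable]
        simp_rw [ENNReal.tsum_mul_left]

/-- Composing with the swap of `a` and `b` shows that `b` is minimal at least as often as `a`, and
for different elements of `T` these events are disjoint. -/
theorem card_mul_card_perm_min_le {n : ℕ} (T : Finset (Fin n)) {a : Fin n} (ha : a ∈ T) :
    T.card * (Finset.univ.filter fun π : Equiv.Perm (Fin n) => ∀ c ∈ T, π a ≤ π c).card ≤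
      Fintype.card (Equiv.Perm (Fin n)) := by
  let A : Fin n → Finset (Equiv.Perm (Fin n)) := fun b =>
    Finset.univ.filter fun π : Equiv.Perm (Fin n) => ∀ c ∈ T, π b ≤ π c
  have hA : ∀ b ∈ T, (A a).card ≤ (A b).card := by
    intro b hb
    refine Finset.card_le_card_of_injOn (fun π => π * Equiv.swap a b) ?_
      (fun π _ π' _ h => mul_right_cancel h)
    intro π hπ
    simp only [A, Finset.coe_filter, Finset.mem_univ, true_and, Set.mem_ofPred_eq,
      Equiv.Perm.mul_apply, Equiv.swap_apply_right] at hπ ⊢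
    intro c hc
    refine hπ _ ?_
    rcases eq_or_ne c a with rfl | h1
    · simpa using hb
    rcases eq_or_ne c b with rfl | h2
    · simpa using ha
    rwa [Equiv.swap_apply_of_ne_of_ne h1 h2]
  have hdisj : (T : Set (Fin n)).PairwiseDisjoint A := by
    intro b hb c hc hbc
    refine Finset.disjoint_left.2 fun π h1 h2 => hbc ?_
    simp only [A, Finset.mem_filter, Finset.mem_univ, true_and] at h1 h2
    exact π.injective (le_antisymm (h1 c hc) (h2 b hb))
  calc T.card * (A a).card ≤ ∑ b ∈ T, (A b).card := by
        simpa using Finset.card_nsmul_le_sum T (fun b => (A b).card) _ hA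
    _ = (T.biUnion A).card := (Finset.card_biUnion hdisj).symm
    _ ≤ _ := Finset.card_le_univ _

theorem tsum_uniform_min_le {M : Type u} {n : ℕ} {S T : Finset M} {e : M → Fin n}
    (he : Set.InjOn e S) (hT : T ⊆ S) {p : M} (hp : p ∈ T) :
    ∑' π : Equiv.Perm (Fin n), PMF.uniformOfFintype (Equiv.Perm (Fin n)) π *
      (if ∀ q ∈ T, π (e p) ≤ π (e q) then 1 else 0) ≤ ((T.card : ENNReal))⁻¹ := by
  classical
  have h := card_mul_card_perm_min_le (T.image e) (Finset.mem_image_of_mem e hp)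
  rw [Finset.card_image_of_injOn (he.mono (by exact_mod_cast hT))] at h
  simp only [Finset.forall_mem_image] at h
  simp only [PMF.uniformOfFintype_apply]
  rw [ENNReal.tsum_mul_left, tsum_fintype, Finset.sum_boole, mul_comm, ← div_eq_mul_inv]
  refine ENNReal.div_le_of_le_mul ?_
  rw [mul_comm, ← div_eq_mul_inv]
  refine (ENNReal.le_div_iff_mul_le (Or.inl ?_) (Or.inl (ENNReal.natCast_ne_top _))).2 ?_
  · simpa using Finset.ne_empty_of_mem hp
  · rw [mul_comm]
    exact_mod_cast h

/-- Insert points by decreasing `f`: a new minimal point contributes the inverse of the new size,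
and the older terms can only decrease. Ties only help. -/
theorem sum_inv_card_le_h {M : Type u} (f : M → ℕ) (S : Finset M) :
    ∑ p ∈ S, (((S.filter fun q => f p ≤ f q).card : ENNReal))⁻¹ ≤ ENNReal.ofReal (h S.card) := by
  classical
  induction S using Finset.induction_on_min_value f with
  | empty => simp
  | insert a s ha hmin ih =>
    rw [Finset.sum_insert ha, Finset.card_insert_of_notMem ha, add_comm]
    have h1 : h (s.card + 1) = h s.card + ((s.card + 1 : ℕ) : ℝ)⁻¹ := by
      simp [h, harmonic_succ]
    have h2 : ((insert a s).filter fun q => f a ≤ f q) = insert a s := by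
      refine Finset.filter_true_of_mem fun q hq => ?_
      rcases Finset.mem_insert.1 hq with rfl | hq
      · exact le_rfl
      · exact hmin q hq
    have h3 : 0 ≤ h s.card := by
      rw [h]
      exact_mod_cast Finset.sum_nonneg fun i _ => by positivity
    rw [h1, h2, ENNReal.ofReal_add h3 (by positivity), Finset.card_insert_of_notMem ha,
      ENNReal.ofReal_inv_of_pos (by positivity), ENNReal.ofReal_natCast]
    gcongr
    refine le_trans (Finset.sum_le_sum fun p _ => ?_) ih
    gcongr
    exact Finset.subset_insert a s

theorem h_mono : Monotone h := by
  refine monotone_nat_of_le_succ fun n => ?_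
  simp only [h, harmonic_succ]
  push_cast
  linarith [show (0 : ℝ) ≤ ((n : ℝ) + 1)⁻¹ by positivity]

theorem h_nonneg (n : ℕ) : 0 ≤ h n := by simpa [h] using h_mono (Nat.zero_le n)

/-- The seed must not depend on the input, whereas `S` does. Numbering `S` inside `Fin n` lets one
random permutation of `Fin n` order every critical set. -/
theorem exists_injOn_fin {M : Type u} {n : ℕ} (hn : 1 ≤ n) (S : Finset M) :
    ∃ e : M → Fin n, S.card ≤ n → Set.InjOn e S := by
  classical
  by_cases hS : S.card ≤ n
  · refine ⟨fun p => if hp : p ∈ S then Fin.castLE hS (S.equivFin ⟨p, hp⟩) else ⟨0, hn⟩, fun _ => ?_⟩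
    intro p hp q hq hpq
    have hp' : p ∈ S := hp
    have hq' : q ∈ S := hq
    simpa [hp', hq'] using hpq
  · exact ⟨fun _ => ⟨0, hn⟩, fun h => absurd h hS⟩

end RandomOrder

/-! ### Exploitation -/

section Exploit

variable {k n : ℕ} {M : Type u}

/-- `p` has the smallest key among the points of `S` whose language is not dead for `σ`. -/
def IsCurrent (S : Finset M) (K : M → List M → Prop) (key : M → Fin n) (σ : List M) (p : M) :
    Prop :=
  p ∈ S ∧ ¬ Dead (K p) σ ∧ ∀ q ∈ S, ¬ Dead (K q) σ → key p ≤ key q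

/-- The plan that follows `G p` while `p` is current. -/
def exploitPlan (S : Finset M) (K : M → List M → Prop) (key : M → Fin n)
    (G : M → List M → Config k M) (C : Config k M) (σ : List M) : Config k M :=
  open Classical in
  if hσ : σ ≠ [] ∧ ∃ p, IsCurrent S K key σ p then G hσ.2.choose σ else C

variable {S : Finset M} {K : M → List M → Prop} {key : M → Fin n}
  {G : M → List M → Config k M} {C : Config k M} {σ τ : List M} {p q : M}

theorem exists_isCurrent (h : ∃ p ∈ S, ¬ Dead (K p) σ) : ∃ p, IsCurrent S K key σ p := by
  classical
  obtain ⟨p, hp, hmin⟩ := (S.filter fun p => ¬ Dead (K p) σ).exists_min_image key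
    (by simpa [Finset.filter_nonempty_iff] using h)
  rw [Finset.mem_filter] at hp
  exact ⟨p, hp.1, hp.2, fun q hq hqσ => hmin q (Finset.mem_filter.2 ⟨hq, hqσ⟩)⟩

theorem exploitPlan_eq (hkey : Set.InjOn key S) (hσ : σ ≠ []) (hp : IsCurrent S K key σ p) :
    exploitPlan S K key G C σ = G p σ := by
  have h : σ ≠ [] ∧ ∃ p, IsCurrent S K key σ p := ⟨hσ, p, hp⟩
  rw [exploitPlan, dif_pos h]
  have h' := h.2.choose_spec
  rw [hkey h'.1 hp.1 (le_antisymm (h'.2.2 p hp.1 hp.2.1) (hp.2.2 _ h'.1 h'.2.1))]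

theorem exploitPlan_nil : exploitPlan S K key G C [] = C := dif_neg (by simp)

/-- Points only die as the string grows, so a current point remains current until its own death and
is never taken up again. -/
theorem IsCurrent.extend (hK : ∀ p, ConvexLang (K p)) (hp : IsCurrent S K key τ p) (h : τ <+: σ)
    (hσ : ¬ Dead (K p) σ) : IsCurrent S K key σ p :=
  ⟨hp.1, hσ, fun q hq hqσ => hp.2.2 q hq fun hd => hqσ (hd.mono (hK q) h)⟩

/-- A point that lives at least as long as `p` was alive when `p` was current, and therefore lost to
`p`. -/
theorem IsCurrent.key_le (hp : IsCurrent S K key τ p) (h : τ <+: σ) (hK : ∀ p, ConvexLang (K p))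
    (hq : q ∈ S) (hpq : (core (K p) σ).length ≤ (core (K q) σ).length) : key p ≤ key q := by
  refine hp.2.2 q hq fun hd => not_dead_core (L := K q) (σ := σ) (hd.mono (hK q) ?_)
  exact List.prefix_of_prefix_length_le h core_prefix
    ((prefix_core h hp.2.1).length_le.trans hpq)

/-! ### Expected cost of exploitation -/

variable [DecidableEq M]

/-- Each point ever followed is charged one jump `W` and the whole cost of its own plan, including
moves that were only simulated. The restriction `τ ≠ []` reflects that the start `C` belongs to no
point. -/
theorem pathCost_exploitPlan_le_of_used {w : ℕ → ℝ} (hw : ∀ j : Fin k, 0 ≤ w (j + 1))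
    (hkey : Set.InjOn key S) (hK : ∀ p, ConvexLang (K p)) {W : ℝ} (hW0 : 0 ≤ W)
    (hW : ∀ σ x, (∃ p ∈ S, ¬ Dead (K p) (σ ++ [x])) →
      moveCost w (exploitPlan S K key G C σ) (exploitPlan S K key G C (σ ++ [x])) ≤ W)
    (hσ : ∃ p ∈ S, ¬ Dead (K p) σ) :
    pathCost w (exploitPlan S K key G C) σ ≤ ∑ p ∈ S, open Classical in
      if ∃ τ, τ <+: σ ∧ τ ≠ [] ∧ IsCurrent S K key τ p then
        W + pathCost w (G p) (core (K p) σ) else 0 := by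
  classical
  induction σ using List.reverseRecOn with
  | nil =>
    refine Finset.sum_nonneg fun p _ => ?_
    split_ifs
    · exact add_nonneg hW0 (pathCost_nonneg hw _ _)
    · exact le_rfl
  | append_singleton σ x ih =>
    have hpre : σ <+: σ ++ [x] := List.prefix_append _ _
    have ih := ih (hσ.imp fun p ⟨hp, hd⟩ => ⟨hp, fun h => hd (h.mono (hK p) hpre)⟩)
    obtain ⟨p, hp⟩ := exists_isCurrent (key := key) hσ
    have hpσ : ¬ Dead (K p) σ := fun h => hp.2.1 (h.mono (hK p) hpre)
    rw [pathCost_concat]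
    refine (add_le_add_left ih _).trans ?_
    -- The last move is charged to the point `p` that is current after it; the other summands can
    -- only grow.
    rw [← Finset.add_sum_erase S _ hp.1, ← Finset.add_sum_erase S _ hp.1, add_right_comm]
    refine add_le_add ?_ (Finset.sum_le_sum fun q _ => ?_)
    · have hcur : ∃ τ, τ <+: σ ++ [x] ∧ τ ≠ [] ∧ IsCurrent S K key τ p :=
        ⟨_, List.prefix_rfl, by simp, hp⟩
      rw [if_pos hcur]
      split_ifs with hu
      -- Already followed and still alive, `p` was current before `x` too, so the move is one of `G
      -- p` itself.
      · obtain ⟨τ, hτ, hne, hτp⟩ := hu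
        have hne' : σ ≠ [] := by
          rintro rfl
          exact hne (List.prefix_nil.1 hτ)
        rw [exploitPlan_eq hkey hne' (hτp.extend hK hτ hpσ), exploitPlan_eq hkey (by simp) hp,
          core_eq_self hpσ, core_eq_self hp.2.1, pathCost_concat, add_assoc]
      -- At the first use of `p` the jump is paid by `W`.
      · rw [zero_add]
        exact (hW σ x hσ).trans (le_add_of_nonneg_right (pathCost_nonneg hw _ _))
    · by_cases hu : ∃ τ, τ <+: σ ∧ τ ≠ [] ∧ IsCurrent S K key τ q
      · rw [if_pos hu, if_pos (hu.imp fun τ hτ => ⟨hτ.1.trans hpre, hτ.2⟩)]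
        exact add_le_add_right (pathCost_mono hw _ (core_mono hpre)) _
      · rw [if_neg hu]
        split_ifs
        · exact add_nonneg hW0 (pathCost_nonneg hw _ _)
        · exact le_rfl

theorem pathCost_exploitPlan_le {w : ℕ → ℝ} (hw : ∀ j : Fin k, 0 ≤ w (j + 1))
    (hkey : Set.InjOn key S) (hK : ∀ p, ConvexLang (K p)) {W : ℝ} (hW0 : 0 ≤ W)
    (hW : ∀ σ x, (∃ p ∈ S, ¬ Dead (K p) (σ ++ [x])) →
      moveCost w (exploitPlan S K key G C σ) (exploitPlan S K key G C (σ ++ [x])) ≤ W)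
    (hσ : ∃ p ∈ S, ¬ Dead (K p) σ) :
    ENNReal.ofReal (pathCost w (exploitPlan S K key G C) σ) ≤ ∑ p ∈ S,
      (if ∀ q ∈ S.filter (fun q => (core (K p) σ).length ≤ (core (K q) σ).length),
        key p ≤ key q then 1 else 0) *
      (ENNReal.ofReal W + ENNReal.ofReal (pathCost w (G p) (core (K p) σ))) := by
  classical
  refine (ENNReal.ofReal_le_ofReal
    (pathCost_exploitPlan_le_of_used hw hkey hK hW0 hW hσ)).trans ?_
  have hnn : ∀ p, 0 ≤ W + pathCost w (G p) (core (K p) σ) := fun p =>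
    add_nonneg hW0 (pathCost_nonneg hw _ _)
  rw [ENNReal.ofReal_sum_of_nonneg fun p _ => by split_ifs <;> simp [hnn p]]
  refine Finset.sum_le_sum fun p _ => ?_
  by_cases hu : ∃ τ, τ <+: σ ∧ τ ≠ [] ∧ IsCurrent S K key τ p
  · obtain ⟨τ, hτ, -, hτp⟩ := id hu
    rw [if_pos hu, if_pos, one_mul, ENNReal.ofReal_add hW0 (pathCost_nonneg hw _ _)]
    intro q hq
    rw [Finset.mem_filter] at hq
    exact hτp.key_le hτ hK hq.1 hq.2
  · simp [hu]

/-- All points share one seed of the given plan: only linearity of expectation over `S` is used,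
together with independence from the random order. -/
theorem HasPlan.exploit {ι κ : Type*} {w : ℕ → ℝ} (hw : ∀ j : Fin k, 0 ≤ w (j + 1)) {l : ℕ}
    (j₀ : Fin k) (hj₀ : (j₀ : ℕ) = l) {D : ι → Config k M → Prop} {K : ι → List M → Prop}
    {b : ENNReal} (hplan : HasPlan w l D K b) (hK : ∀ i, ConvexLang (K i)) {n : ℕ} (hn : 1 ≤ n)
    {W : ℝ} (hW : ∑ i ∈ Finset.range (l + 1), w (i + 1) ≤ W)
    (S : κ → Finset M) (t : κ → M → ι) {D' : κ → Config k M → Prop}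
    (hD' : ∀ i C, D' i C → (S i).Nonempty ∧ (S i).card ≤ n ∧
      ∀ p ∈ S i, D (t i p) (Function.update C j₀ p)) :
    HasPlan w (l + 1) D' (fun i => exploitLang (S i) (fun p => K (t i p)))
      (ENNReal.ofReal (h n) * (ENNReal.ofReal W + b)) := by
  obtain ⟨Seed, law, g, hg⟩ := hplan
  choose e he using fun S : Finset M => exists_injOn_fin hn S
  let key : Equiv.Perm (Fin n) → κ → M → Fin n := fun π i p => π (e (S i) p)
  let G : Seed → κ → Config k M → M → List M → Config k M := fun ω i C p =>
    g ω (t i p) (Function.update C j₀ p)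
  let g' : Seed × Equiv.Perm (Fin n) → κ → Config k M → List M → Config k M := fun ω i C =>
    exploitPlan (S i) (fun p => K (t i p)) (key ω.2 i) (G ω.1 i C) C
  have hkey : ∀ π i C, D' i C → Set.InjOn (key π i) (S i) := fun π i C hC p hp q hq hpq =>
    he (S i) (hD' i C hC).2.1 hp hq (π.injective hpq)
  have halive : ∀ i C, D' i C → ∀ σ, ¬ Dead (exploitLang (S i) (fun p => K (t i p))) σ →
      ∃ p ∈ S i, ¬ Dead (K (t i p)) σ := by
    intro i C hC σ hσ
    rw [dead_exploitLang_iff (hD' i C hC).1] at hσ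
    push Not at hσ
    exact hσ
  have hstep : ∀ ω i C, D' i C → ∀ σ, σ ≠ [] → (∃ p ∈ S i, ¬ Dead (K (t i p)) σ) →
      ∃ p ∈ S i, ¬ Dead (K (t i p)) σ ∧ g' ω i C σ = G ω.1 i C p σ := by
    intro ω i C hC σ hne hσ
    obtain ⟨p, hp⟩ := exists_isCurrent (K := fun p => K (t i p)) (key := key ω.2 i) hσ
    exact ⟨p, hp.1, hp.2.1, exploitPlan_eq (hkey _ i C hC) hne hp⟩
  have hlight : ∀ ω i C, D' i C → ∀ σ, (∃ p ∈ S i, ¬ Dead (K (t i p)) σ) →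
      ∀ j : Fin k, l + 1 ≤ (j : ℕ) → g' ω i C σ j = C j := by
    intro ω i C hC σ hσ j hj
    rcases eq_or_ne σ [] with rfl | hne
    · exact congrFun exploitPlan_nil j
    · obtain ⟨p, hp, hpσ, h⟩ := hstep ω i C hC σ hne hσ
      rw [h, show G ω.1 i C p σ j = _ from
        hg.light _ _ _ ((hD' i C hC).2.2 p hp) σ hpσ j (by omega),
        Function.update_of_ne (by rintro rfl; omega)]
  refine ⟨Seed × Equiv.Perm (Fin n), prodLaw law (PMF.uniformOfFintype _), g',
    fun ω i C _ => exploitPlan_nil, ?_, fun ω i C hC σ hσ =>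
      hlight ω i C hC σ (halive i C hC σ hσ), ?_⟩
  · intro ω i C hC σ x hx
    obtain ⟨p, hp, hpσ, h⟩ := hstep ω i C hC _ (by simp) (halive i C hC _ hx)
    rw [h]
    exact hg.serves _ _ _ ((hD' i C hC).2.2 p hp) _ _ hpσ
  · intro i C hC σ hσ
    have hσ' := halive i C hC σ hσ
    have hW0 : 0 ≤ W := (Finset.sum_nonneg fun j hj =>
      hw ⟨j, by have := j₀.2; rw [Finset.mem_range] at hj; omega⟩).trans hW
    let T : M → Finset M := fun p => (S i).filter fun q =>
      (core (K (t i p)) σ).length ≤ (core (K (t i q)) σ).length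
    have hcost : ∀ ω π, ENNReal.ofReal (pathCost w (g' (ω, π) i C) σ) ≤ ∑ p ∈ S i,
        (if ∀ q ∈ T p, π (e (S i) p) ≤ π (e (S i) q) then 1 else 0) * (ENNReal.ofReal W +
          ENNReal.ofReal (pathCost w (G ω i C p) (core (K (t i p)) σ))) := by
      intro ω π
      refine pathCost_exploitPlan_le (K := fun p => K (t i p)) hw (hkey π i C hC)
        (fun p => hK _) hW0 (fun τ x hτ => ?_) hσ'
      -- All configurations visited agree with `C` outside the lightest `l + 1` servers, so any jump
      -- costs at most `W`.
      refine (moveCost_le_of_eq_heavy hw (l := l + 1) (by have := j₀.2; omega)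
        fun j hj => ?_).trans hW
      have hτ' : ∃ p ∈ S i, ¬ Dead (K (t i p)) τ := hτ.imp fun p ⟨hp, hd⟩ =>
        ⟨hp, fun h => hd (h.mono (hK _) (List.prefix_append _ _))⟩
      exact (hlight (ω, π) i C hC τ hτ' j hj).trans (hlight (ω, π) i C hC _ hτ j hj).symm
    rw [tsum_prodLaw]
    calc _ ≤ ∑' ω, law ω * ∑' π, PMF.uniformOfFintype (Equiv.Perm (Fin n)) π * ∑ p ∈ S i,
          (if ∀ q ∈ T p, π (e (S i) p) ≤ π (e (S i) q) then 1 else 0) * (ENNReal.ofReal W +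
            ENNReal.ofReal (pathCost w (G ω i C p) (core (K (t i p)) σ))) := by
          refine ENNReal.tsum_le_tsum fun ω => mul_le_mul_right
            (ENNReal.tsum_le_tsum fun π => mul_le_mul_right (hcost ω π) _) _
      _ = ∑ p ∈ S i, (∑' π, PMF.uniformOfFintype (Equiv.Perm (Fin n)) π *
          (if ∀ q ∈ T p, π (e (S i) p) ≤ π (e (S i) q) then 1 else 0)) *
          ∑' ω, law ω * (ENNReal.ofReal W +
            ENNReal.ofReal (pathCost w (G ω i C p) (core (K (t i p)) σ))) := by
          exact tsum_mul_tsum_mul_sum _ _ _ _ _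
      _ ≤ ∑ p ∈ S i, ((T p).card : ENNReal)⁻¹ * (ENNReal.ofReal W + b) := by
          refine Finset.sum_le_sum fun p hp => mul_le_mul' ?_ ?_
          · exact tsum_uniform_min_le (he (S i) (hD' i C hC).2.1) (Finset.filter_subset _ _)
              (Finset.mem_filter.2 ⟨hp, le_rfl⟩)
          · simp_rw [mul_add]
            rw [ENNReal.tsum_add, ENNReal.tsum_mul_right, PMF.tsum_coe, one_mul]
            gcongr
            exact hg.cost _ _ ((hD' i C hC).2.2 p hp) _ not_dead_core
      _ ≤ _ := by
          rw [← Finset.sum_mul]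
          gcongr
          exact (sum_inv_card_le_h _ _).trans
            (ENNReal.ofReal_le_ofReal (h_mono (hD' i C hC).2.1))

end Exploit

/-! ### Weights -/

section Weights

/-- The hypotheses on the server weights. -/
def IsWeight (k : ℕ) (w : ℕ → ℝ) : Prop :=
  0 ≤ w 1 ∧ ∀ i, 1 ≤ i → i < k → w i < w (i + 1) ∧ ∃ m : ℕ, w (i + 1) = m * w i

variable {k : ℕ} {w : ℕ → ℝ} {l : ℕ}

theorem IsWeight.nonneg (hw : IsWeight k w) (hl : 1 ≤ l) (hk : l ≤ k) : 0 ≤ w l := by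
  induction l, hl using Nat.le_induction with
  | base => exact hw.1
  | succ l hl ih => exact (ih (by omega)).trans (hw.2 l hl (by omega)).1.le

theorem IsWeight.nonneg_fin (hw : IsWeight k w) (j : Fin k) : 0 ≤ w (j + 1) :=
  hw.nonneg (by omega) (by omega)

/-- A zero weight has only zero as a multiple, so no strictly larger weight could follow it. -/
theorem IsWeight.pos (hw : IsWeight k w) (hl : 1 ≤ l) (hk : l < k) : 0 < w l := by
  obtain ⟨h1, m, h2⟩ := hw.2 l hl hk
  refine (hw.nonneg hl hk.le).lt_of_ne' fun h0 => ?_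
  rw [h2, h0] at h1
  simp at h1

theorem IsWeight.ratio_mul (hw : IsWeight k w) (hl : 1 ≤ l) (hk : l < k) :
    (ratio w l : ℝ) * w l = w (l + 1) := by
  obtain ⟨-, m, h2⟩ := hw.2 l hl hk
  have h0 := (hw.pos hl hk).ne'
  rw [ratio, h2, mul_div_cancel_right₀ _ h0, Nat.floor_natCast]

theorem IsWeight.two_le_ratio (hw : IsWeight k w) (hl : 1 ≤ l) (hk : l < k) : 2 ≤ ratio w l := by
  by_contra hlt
  have h1 : (ratio w l : ℝ) ≤ 1 := by exact_mod_cast (show ratio w l ≤ 1 by omega)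
  have h2 := mul_le_mul_of_nonneg_right h1 (hw.nonneg hl hk.le)
  rw [hw.ratio_mul hl hk, one_mul] at h2
  exact absurd (hw.2 l hl hk).1 (not_lt.2 h2)

/-- Weights at least double at each step, so the sum is dominated by a geometric series. -/
theorem IsWeight.sum_le (hw : IsWeight k w) (hl : 1 ≤ l) (hk : l ≤ k) :
    ∑ i ∈ Finset.range l, w (i + 1) ≤ 2 * w l := by
  induction l, hl using Nat.le_induction with
  | base => simpa using by linarith [hw.1]
  | succ l hl ih =>
    rw [Finset.sum_range_succ]
    have h1 : (2 : ℝ) ≤ ratio w l := by exact_mod_cast hw.two_le_ratio hl (by omega)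
    have h2 := mul_le_mul_of_nonneg_right h1 (hw.nonneg hl (by omega))
    rw [hw.ratio_mul hl (by omega)] at h2
    linarith [ih (by omega)]

theorem IsWeight.good_isPhase {M : Type u} [LinearOrder M] (hw : IsWeight k w) (hl : 1 ≤ l)
    (hk : l ≤ k) (H : Finset M) : Good (IsPhase w l H) :=
  KServer.good_isPhase w l hl (fun i hi hil =>
    (show 1 ≤ 2 by decide).trans (hw.two_le_ratio hi (by omega))) H

theorem IsWeight.good_isMultiphase {M : Type u} [LinearOrder M] (hw : IsWeight k w) (hl : 1 ≤ l)
    (hk : l < k) (H : Finset M) : Good (IsMultiphase w l H) :=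
  Good.isSeqOf (hw.good_isPhase hl hk.le)
    ((show 1 ≤ 2 by decide).trans (hw.two_le_ratio hl hk)) H

theorem c_nonneg (l : ℕ) : 0 ≤ c l := by
  induction l using Nat.strong_induction_on with
  | _ l ih =>
    match l with
    | 0 => simp [c]
    | 1 => simp [c]
    | l + 2 =>
      rw [c]
      have h1 := ih (l + 1) (by omega)
      have h2 := h_nonneg (d (l + 2) - 1)
      positivity

theorem one_le_d_sub_one (l : ℕ) : 1 ≤ d (l + 2) - 1 := by
  have h1 : 5 ^ 1 ≤ 5 ^ (l + 1) := Nat.pow_le_pow_right (by norm_num) (by omega)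
  have h2 : 2 ^ 1 ≤ 2 ^ (5 ^ (l + 1) - 1) := Nat.pow_le_pow_right (by norm_num) (by omega)
  rw [d, show l + 2 - 1 = l + 1 by omega]
  omega

end Weights

/-! ### The strategies -/

section Main

variable {k : ℕ} {M : Type u} [LinearOrder M] {w : ℕ → ℝ} {l : ℕ}

/-- Move the lightest server to the first request outside `H`. -/
def onePlan (j₀ : Fin k) (H : Finset M) (C : Config k M) (σ : List M) : Config k M :=
  match σ.find? (fun x => decide (x ∉ H)) with
  | none => C
  | some p => Function.update C j₀ p

theorem onePlan_apply_of_ne (j₀ : Fin k) (H : Finset M) (C : Config k M) (σ : List M) {j : Fin k}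
    (hj : j ≠ j₀) : onePlan j₀ H C σ j = C j := by
  unfold onePlan
  cases σ.find? (fun x => decide (x ∉ H)) with
  | none => rfl
  | some p => exact Function.update_of_ne hj _ _

theorem pathCost_onePlan_le (hw : ∀ j : Fin k, 0 ≤ w (j + 1)) (j₀ : Fin k) (H : Finset M)
    (C : Config k M) (σ : List M) :
    pathCost w (onePlan j₀ H C) σ ≤
      if (σ.find? (fun x => decide (x ∉ H))).isSome then w (j₀ + 1) else 0 := by
  induction σ using List.reverseRecOn with
  | nil => simp
  | append_singleton σ x ih =>
    rw [pathCost_concat]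
    cases hσ : σ.find? (fun x => decide (x ∉ H)) with
    | some p =>
      have h : (σ ++ [x]).find? (fun x => decide (x ∉ H)) = some p := by
        rw [List.find?_append, hσ]
        rfl
      have h' : onePlan j₀ H C σ = onePlan j₀ H C (σ ++ [x]) := by
        rw [onePlan, onePlan, h, hσ]
      rw [hσ] at ih
      rw [← h', h, moveCost_self, add_zero]
      exact ih
    | none =>
      rw [hσ] at ih
      have hle : pathCost w (onePlan j₀ H C) σ ≤ 0 := by simpa using ih
      have h : (σ ++ [x]).find? (fun x => decide (x ∉ H)) =
          [x].find? (fun x => decide (x ∉ H)) := by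
        rw [List.find?_append, hσ]
        rfl
      have h1 : onePlan j₀ H C σ = C := by rw [onePlan, hσ]
      rw [h, h1]
      by_cases hx : x ∈ H
      · have h2 : onePlan j₀ H C (σ ++ [x]) = C := by
          rw [onePlan, h]
          simp [hx]
        rw [h2]
        simpa [hx] using hle
      · have h2 : moveCost w C (onePlan j₀ H C (σ ++ [x])) ≤ w (j₀ + 1) := by
          rw [moveCost, Finset.sum_eq_single j₀]
          · split_ifs <;> simp [hw j₀]
          · intro j _ hj
            rw [onePlan_apply_of_ne j₀ H C _ hj]
            simp
          · simp
        simpa [hx] using add_le_add hle h2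

theorem exists_onePlan_eq (j₀ : Fin k) {H : Finset M} {C : Config k M}
    (hC : ∀ p ∈ H, ∃ j : Fin k, j ≠ j₀ ∧ C j = p) {σ : List M} {x : M}
    (hx : ¬ Dead (lang (IsPhase w 1 H)) (σ ++ [x])) : ∃ j, onePlan j₀ H C (σ ++ [x]) j = x := by
  by_cases hxH : x ∈ H
  · obtain ⟨j, hj, rfl⟩ := hC x hxH
    exact ⟨j, onePlan_apply_of_ne j₀ H C _ hj⟩
  · refine ⟨j₀, ?_⟩
    cases hσ : (σ ++ [x]).find? (fun x => decide (x ∉ H)) with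
    | none => simpa using (List.find?_eq_none.1 hσ x (by simp)) (by simpa using hxH)
    | some p =>
      rw [onePlan, hσ]
      simp only [Function.update_self]
      obtain ⟨hp, as, bs, h1, h2⟩ := List.find?_eq_some_iff_append.1 hσ
      simp only [decide_eq_true_eq, Bool.not_eq_true', decide_eq_false_iff_not, not_not] at hp h2
      by_contra hne
      -- If `x` differed from the first request `p` outside `H`, the string would be dead: the
      -- prefix ending at that `p` is a phase, while two distinct points outside `H` are too many.
      refine hx ⟨?_, as ++ [p], ⟨bs, by rw [h1]; simp⟩, _, p, hp, by simp, ?_, rfl⟩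
      · rintro ⟨_, q, hq, -, hall, -⟩
        have h3 := (hall x (by simp)).resolve_left hxH
        have h4 := (hall p (by rw [h1]; simp)).resolve_left hp
        exact hne (h4.trans h3.symm)
      · intro y hy
        rcases List.mem_append.1 hy with hy | hy
        · exact Or.inl (h2 y hy)
        · exact Or.inr (List.mem_singleton.1 hy)

theorem exists_isPhaseStrategy_one (hk : 1 ≤ k) (hw : IsWeight k w) :
    ∃ A : RandomizedAlg k M, IsPhaseStrategy w 1 A := by
  refine HasPlan.exists_strategy (hw.good_isPhase le_rfl hk) ?_
  let j₀ : Fin k := ⟨0, hk⟩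
  have hne : ∀ j : Fin k, 1 ≤ (j : ℕ) → j ≠ j₀ := by
    rintro j hj rfl
    simp [j₀] at hj
  refine ⟨Unit, PMF.pure (), fun _ => onePlan j₀, fun _ _ _ _ => rfl, ?_, ?_, ?_⟩
  · intro _ H C hC σ x hx
    exact exists_onePlan_eq j₀ (fun p hp => (hC.2 p hp).imp fun j hj => ⟨hne j hj.1, hj.2⟩) hx
  · intro _ H C _ σ _ j hj
    exact onePlan_apply_of_ne j₀ H C σ (hne j hj)
  · intro H C _ σ _
    have h1 := pathCost_onePlan_le hw.nonneg_fin j₀ H C σ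
    have h2 : pathCost w (onePlan j₀ H C) σ ≤ c 1 * w 1 := by
      refine h1.trans ?_
      split_ifs <;> simp [c, j₀, hw.1]
    simpa using ENNReal.ofReal_le_ofReal h2

theorem exists_isMultiphaseStrategy (hw : IsWeight k w) (hl : 1 ≤ l) (hk : l < k)
    (h : ∃ A : RandomizedAlg k M, IsPhaseStrategy w l A) :
    ∃ A : RandomizedAlg k M, IsMultiphaseStrategy w l A := by
  obtain ⟨A, hA⟩ := h
  refine HasPlan.exists_strategy (hw.good_isMultiphase hl hk) ?_
  refine (HasPlan.isSeqOf hw.nonneg_fin (hw.good_isPhase hl hk.le)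
    (hA.hasPlan (hw.good_isPhase hl hk.le))
    ((show 1 ≤ 2 by decide).trans (hw.two_le_ratio hl hk))).mono (le_of_eq ?_)
  rw [← ENNReal.ofReal_natCast, ← ENNReal.ofReal_mul (by positivity), ← hw.ratio_mul hl hk]
  congr 1
  ring

/-- Server number `l + 1` is not needed to cover `H`, so parking it at `p` covers one more point. -/
theorem Covered.update {H : Finset M} {C : Config k M} (h : Covered (l + 1) H C) {j₀ : Fin k}
    (hj₀ : (j₀ : ℕ) = l) (p : M) : Covered l (insert p H) (Function.update C j₀ p) := by
  have hk := j₀.2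
  refine ⟨(Finset.card_insert_le _ _).trans (by have := h.1; omega), fun q hq => ?_⟩
  rcases Finset.mem_insert.1 hq with rfl | hq
  · exact ⟨j₀, hj₀.ge, Function.update_self _ _ _⟩
  · obtain ⟨j, hj, rfl⟩ := h.2 q hq
    exact ⟨j, by omega, Function.update_of_ne (by rintro rfl; omega) _ _⟩

theorem exists_isPhaseStrategy_succ [WellFoundedLT M] (hw : IsWeight k w) (hl : 1 ≤ l)
    (hk : l < k) (h : ∃ A : RandomizedAlg k M, IsMultiphaseStrategy w l A) :
    ∃ A : RandomizedAlg k M, IsPhaseStrategy w (l + 1) A := by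
  obtain ⟨A, hA⟩ := h
  obtain ⟨l, rfl⟩ := Nat.exists_eq_add_of_le' hl
  have hgood := hw.good_isMultiphase (M := M) hl hk
  have hB := hA.hasPlan hgood
  have hn := one_le_d_sub_one l
  generalize hnd : d (l + 2) - 1 = n at hn
  have hE := hB.exploit hw.nonneg_fin ⟨l + 1, hk⟩ rfl (fun H => (hgood H).convex) hn
    (hw.sum_le (by omega) hk) (κ := Finset M × (M →₀ ℝ)) (fun i => top n i.2)
    (fun i p => insert p i.1) (D' := fun i C => Covered (l + 2) i.1 C) (fun i C hC =>
      have : Nonempty M := ⟨C ⟨l + 1, hk⟩⟩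
      ⟨top_nonempty hn _, card_top_le _ _, fun p _ => hC.update rfl p⟩)
  -- The explore part leaves server number `l + 2` where it is and runs the multiphase plan on the
  -- more restricted inputs.
  have hB' : HasPlan w (l + 1) (Covered (k := k) (l + 2))
      (fun H : Finset M => lang (IsMultiphase w (l + 1) H))
      (ENNReal.ofReal (c (l + 1) * w (l + 1 + 1))) := by
    obtain ⟨Seed, law, g, hg⟩ := hB
    exact ⟨Seed, law, g, fun ω H C hC => hg.nil ω H C hC.of_succ,
      fun ω H C hC => hg.serves ω H C hC.of_succ, fun ω H C hC => hg.light ω H C hC.of_succ,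
      fun H C hC => hg.cost H C hC.of_succ⟩
  have hplan := hB'.concat hw.nonneg_fin (Nat.le_succ _) hE (fun H => (hgood H).convex)
    (fun i => by
      rw [← lang_exploitSpec]
      exact (Good.exploit fun p _ => hgood _).nil)
    (fun H ρ => (H, demand (IsMultiphase w (l + 1) H) ρ))
    (fun H C ρ C' hC _ hC' => hC.congr fun j hj => hC' j (by omega))
  refine HasPlan.exists_strategy (hw.good_isPhase (by omega) hk) ?_
  simp_rw [isPhase_add_two, (hgood _).lang_concatSpec, lang_exploitSpec, hnd]
  -- With `W = 2 * w (l + 2)`, explore and exploit costs add up to the recursion defining `c (l +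
  -- 2)`.
  refine hplan.mono (le_of_eq ?_)
  have h1 := c_nonneg (l + 1)
  have h2 := h_nonneg n
  have h3 : 0 ≤ w (l + 1 + 1) := hw.nonneg (by omega) hk
  rw [← ENNReal.ofReal_add (by positivity) (by positivity), ← ENNReal.ofReal_mul h2,
    ← ENNReal.ofReal_add (by positivity) (by positivity), c, hnd]
  congr 1
  ring

theorem exists_isPhaseStrategy [WellFoundedLT M] (hw : IsWeight k w) (hl : 1 ≤ l) (hk : l ≤ k) :
    ∃ A : RandomizedAlg k M, IsPhaseStrategy w l A := by
  induction l, hl using Nat.le_induction with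
  | base => exact exists_isPhaseStrategy_one hk hw
  | succ l hl ih =>
    exact exists_isPhaseStrategy_succ hw hl hk
      (exists_isMultiphaseStrategy hw hl hk (ih (by omega)))

end Main

end KServer

end

theorem mainTheorem4 {M : Type*} [LinearOrder M] [WellFoundedLT M] (k : ℕ) (hk : 1 ≤ k)
    (w : ℕ → ℝ) (hw0 : 0 ≤ w 1)
    (hw : ∀ i, 1 ≤ i → i < k → w i < w (i + 1) ∧ ∃ m : ℕ, w (i + 1) = m * w i) :
    (∃ A : KServer.RandomizedAlg k M, KServer.IsPhaseStrategy w 1 A) ∧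
    (∀ l, 1 ≤ l → l ≤ k - 1 →
      (∃ A : KServer.RandomizedAlg k M, KServer.IsPhaseStrategy w l A) →
      ∃ A : KServer.RandomizedAlg k M, KServer.IsMultiphaseStrategy w l A) ∧
    (∀ l, 2 ≤ l → l ≤ k →
      (∃ A : KServer.RandomizedAlg k M, KServer.IsMultiphaseStrategy w (l - 1) A) →
      ∃ A : KServer.RandomizedAlg k M, KServer.IsPhaseStrategy w l A) ∧
    (∃ A : KServer.RandomizedAlg k M, KServer.IsPhaseStrategy w k A) := by
  have hW : KServer.IsWeight k w := ⟨hw0, hw⟩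
  refine ⟨KServer.exists_isPhaseStrategy_one hk hW,
    fun l hl hlk h => KServer.exists_isMultiphaseStrategy hW hl (by omega) h,
    fun l hl hlk h => ?_, KServer.exists_isPhaseStrategy hW hk le_rfl⟩
  obtain ⟨l, rfl⟩ := Nat.exists_eq_add_of_le' (show 1 ≤ l by omega)
  exact KServer.exists_isPhaseStrategy_succ hW (by omega) (by omega) h
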